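/- **Network.** Time is slotted. A base station (BS) serves three users $c_1,c_2,c_3$, all of whom want every packet. In each slot at most one packet arrives at the BS, with probability $\lambda$, independently over slots. The channel state $\mathbf s(t)=(s_1(t),s_2(t),s_3(t))\in\{0,1\}^3$ is i.i.d. over slots, independent of the arrivals, known before the transmission of slot $t$, and each of its eight values has positive probability. In each slot at most one packet is transmitted: either the BS broadcasts a packet, which reaches exactly the users with $s_i(t)=1$; or a user broadcasts to all users, without error, a packet which that user was told to share. The BS can tell a user $c_i$ to store and share a packet when $c_i$ receives it and no user has had it before; from then on that packet is left to $c_i$. Every other packet is (re-)transmitted by the BS. A schedule chooses the transmission of each slot on-line, i.e. from the past (possibly with randomization) and the current channel state. A queue $X(t)$ is *stable* if $\limsup_{N\to\infty}\frac1N\sum_{t<N}\mathbb E|X(t)|<\infty$. The queue of the network is the number of arrived packets that some user has not received. The *equal-reciprocal constraint* says that, almost surely, for all $i,j$, the number of packets that $c_i$ delivers to $c_j$ by broadcasting and the number that $c_j$ delivers to $c_i$, both divided by the elapsed time, have a difference tending to $0$. The *equal-reciprocal stability region* $\mathbf\Lambda$ is the set of all $\lambda$ for which some schedule, started without packets, makes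 the queue stable and meets the equal-reciprocal constraint. **Virtual network.** Its nodes are $v_a$ (packets waiting at the BS), $v_i$ for $i=1,2,3$ (packets to be shared by $c_i$), and $v^{r}$ for $r\in\{0,1\}^3$ (packets (re-)transmitted by the BS; $r_i=1$ iff $c_i$ has the packet). The node $v^{(1,1,1)}$ is the destination and has the empty queue. The links are: $v_a\to v_i$, ON iff $s_i(t)=1$; $v_i\to v^{(1,1,1)}$, always ON; $v_a\to v^{r}$, ON iff $\mathbf s(t)=r$; and $v^{r}\to v^{r'}$ for $r'\ge r$, $r'\ne r$, ON iff $s_i(t)=r'_i$ for every $i$ with $r_i=0$. Node $u$ has a queue $V_u(t)\ge 0$, and for $1\le i<j\le 3$ there is a signed equal-reciprocal queue $h_{i,j}$ with content $H_{i,j}(t)$. All queues are empty at time $0$. **Algorithm.** For a link $l=u\to d$ put $W_l(t)=\max\{0,V_u(t)-V_d(t)\}$. Let $\mu_l(t)=1$ if $l$ is ON and scheduled, else $0$. Let $n_{i,j}(t)=1$ if $v_a\to v_i$ is scheduled and $s_j(t)=0$, else $0$. In each slot, schedule an admissible link that maximizes $$\sum_{l}W_l(t)\mu_l(t)+\sum_{1\le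 i<j\le 3}H_{i,j}(t)\,(n_{j,i}(t)-n_{i,j}(t)),$$ with ties broken by any on-line rule; if no admissible link gives a positive value, schedule no link. For the word *admissible* two conventions are considered: (A) a link $u\to d$ is admissible if it is ON and $V_u(t)\ge1$; (B) a link is admissible if it is ON (an empty queue then sends a fill packet). If $u\to d$ is scheduled, then a packet that is at $u$ is transmitted, if there is one (by the BS, which tells $c_i$ to share it, if the link is $v_a\to v_i$; by user $c_i$ if $u=v_i$; by the BS without sharing otherwise), and it moves to $d$. The queues are updated by $V_u(t+1)=\max\{0,V_u(t)-1\}$ and $V_d(t+1)=V_d(t)+1$ (for $d\neq v^{(1,1,1)}$), by adding $1$ to $V_{v_a}$ if a packet arrives, and by $H_{i,j}(t+1)=H_{i,j}(t)+n_{i,j}(t)-n_{j,i}(t)$. **Theorem.** Let $\lambda$ be in the interior of $\mathbf\Lambda$. Under the algorithm, with either convention, 1. all queues $V_u$ of the virtual network are stable; 2. all equal-reciprocal queues $h_{i,j}$ are stable; 3. almost surely $\frac1N\sum_{t<N}(n_{i,j}(t)-n_{j,i}(t))\to0$ as $N\to\infty$, for all $i,j$; 4. the transmissions form a schedule of the network,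 and the queue of the network is stable; 5. with convention (A), this schedule also meets the equal-reciprocal constraint. In particular, with convention (A) the algorithm is an optimal equal-reciprocal scheme: it is throughput-optimal subject to the equal-reciprocal incentive. -/

import Mathlib

open MeasureTheory ProbabilityTheory Filter Topology

namespace SocialGrouping

/-- Channel state vector of one slot: `s i = true` iff the channel from the base station to user `i`
is ON.  The same type records which users have received a packet. -/
abbrev Channel : Type := Fin 3 → Bool

/-- State of the network: `num` packets have arrived at the base station so far, numbered
`0, ..., num - 1`; `has k i = true` iff user `i` has received packet `k`; and `holder k` is the user,
if any, who was told to store packet `k` and to share it. -/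
@[ext]
structure Network : Type where
  num : ℕ
  has : ℕ → Channel
  holder : ℕ → Option (Fin 3)

/-- No packet has arrived. -/
def Network.empty : Network := ⟨0, fun _ _ => false, fun _ => none⟩

/-- What can be done in one slot (at most one packet is transmitted per slot).
* `bs k none`: the base station broadcasts packet `k`;
* `bs k (some i)`: the base station broadcasts packet `k` and tells user `i` to store and share it;
* `d2d i k`: user `i` broadcasts packet `k` to the other users. -/
inductive Transmission : Type
  | idle : Transmission
  | bs (k : ℕ) (i : Option (Fin 3)) : Transmission
  | d2d (i : Fin 3) (k : ℕ) : Transmission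

/-- The transmissions that are possible when the channel state is `s`.  A user can be told to share a
packet when the user receives it and nobody has had it before; from then on the packet is left to
this user.  All other packets are (re-)transmitted by the base station. -/
def Network.Allowed (s : Channel) (x : Network) : Transmission → Prop
  | .idle => True
  | .bs k none => k < x.num ∧ x.holder k = none
  | .bs k (some i) => k < x.num ∧ x.holder k = none ∧ (∀ j, x.has k j = false) ∧ s i = true
  | .d2d i k => k < x.num ∧ x.holder k = some i

/-- One slot of the network: a broadcast of the base station reaches the users whose channel is ON,
a broadcast of a user reaches all users, and a packet arrives iff `a = true`. -/
def Network.step (s : Channel) (T : Transmission) (a : Bool) (x : Network) : Network where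
  num := x.num + if a = true then 1 else 0
  has := match T with
    | .idle => x.has
    | .bs k _ => Function.update x.has k (fun j => x.has k j || s j)
    | .d2d _ k => Function.update x.has k (fun _ => true)
  holder := match T with
    | .bs k (some i) => Function.update x.holder k (some i)
    | _ => x.holder

/-- Queue length: the number of packets that have arrived and that some user has not received. -/
def Network.backlog (x : Network) : ℕ :=
  ((Finset.range x.num).filter (fun k => ∃ i, x.has k i = false)).card

open Classical in
/-- `1` if user `i` delivers a packet to user `j` by the transmission `T`, else `0`. -/
noncomputable def Network.shared (x : Network) (T : Transmission) (i j : Fin 3) : ℤ :=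
  if ∃ k, T = .d2d i k ∧ x.has k j = false then 1 else 0

/-- The network over time, starting without packets. -/
def netTraj {Ω : Type*} (s : ℕ → Ω → Channel) (A : ℕ → Ω → Bool)
    (T : ℕ → Ω → Transmission) : ℕ → Ω → Network
  | 0, _ => Network.empty
  | t + 1, ω => (netTraj s A T t ω).step (s t ω) (T t ω) (A t ω)

/-- The nodes of the virtual network.
* `source`: packets waiting at the base station, not transmitted yet;
* `user i`: packets stored by user `i`, who will share them with the other users;
* `status r`: packets that the base station itself (re-)transmits, where `r i = true` iff user `i`
  already has the packet. -/
inductive Node : Type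
  | source : Node
  | user (i : Fin 3) : Node
  | status (r : Channel) : Node
  deriving DecidableEq

namespace Node

/-- The destination `(1,1,1)`: every user has the packet. It holds no queue. -/
def dest : Node := status (fun _ => true)

/-- `IsLink u d`: the virtual network has a link `u → d`. -/
def IsLink : Node → Node → Prop
  | source, user _ => True
  | user _, status r => r = fun _ => true
  | source, status _ => True
  | status r, status r' => r ≠ r' ∧ ∀ i, r i = true → r' i = true
  | _, _ => False

/-- `IsOn s u d`: the link `u → d` is ON when the channel state is `s`. -/
def IsOn (s : Channel) : Node → Node → Prop
  | source, user i => s i = true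
  | user _, status _ => True
  | source, status r => ∀ i, s i = r i
  | status r, status r' => ∀ i, r i = false → s i = r' i
  | _, _ => False

end Node

/-- Nodes correspond to the elements of a finite type. -/
def Node.equivSum : Node ≃ Unit ⊕ Fin 3 ⊕ Channel where
  toFun
    | .source => .inl ()
    | .user i => .inr (.inl i)
    | .status r => .inr (.inr r)
  invFun
    | .inl _ => .source
    | .inr (.inl i) => .user i
    | .inr (.inr r) => .status r
  left_inv := by rintro (_ | _ | _) <;> rfl
  right_inv := by rintro (_ | _ | _) <;> rfl

instance : Fintype Node := Fintype.ofEquiv _ Node.equivSum.symm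

/-- The set of all virtual links. -/
abbrev Link : Type := {e : Node × Node // e.1.IsLink e.2}

namespace Link

/-- Upstream node. -/
def tail (l : Link) : Node := l.1.1

/-- Downstream node. -/
def head (l : Link) : Node := l.1.2

end Link

noncomputable instance : Fintype Link := Fintype.ofFinite _

/-- The pairs `(i, j)` of users with `i < j`, which index the equal-reciprocal queues. -/
abbrev Pair : Type := {p : Fin 3 × Fin 3 // p.1 < p.2}

/-- Contents of all queues: `V u` is the queue of node `u`, and `H (i, j)`, which is signed, the
equal-reciprocal queue of the pair `i < j`. -/
@[ext]
structure State : Type where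
  V : Node → ℕ
  H : Pair → ℤ

/-- All queues empty. -/
def State.empty : State := ⟨fun _ => 0, fun _ => 0⟩

/-- A decision for one slot: the scheduled link, or `none` if no link is scheduled.
All links interfere, hence at most one is scheduled. -/
abbrev Decision : Type := Option Link

/-- `n s d i j = 1` if the link `source → user i` is scheduled while the channel of `j` is OFF, that
is, if `i` gets a packet that `i` stores and will share with `j`. -/
def n (s : Channel) (d : Decision) (i j : Fin 3) : ℤ :=
  if d.map Subtype.val = some (Node.source, Node.user i) ∧ s j = false then 1 else 0

/-- Queueing update of one slot with channel state `s`, decision `d`, and a packet arrival at the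
source iff `a = true`.  The subtraction is truncated: `max {0, V u - 1}`. -/
def step (s : Channel) (d : Decision) (a : Bool) (x : State) : State where
  V u :=
    if u = Node.dest then 0
    else (x.V u - (if d.map Link.tail = some u then 1 else 0))
      + (if d.map Link.head = some u then 1 else 0)
      + (if u = Node.source ∧ a = true then 1 else 0)
  H p := x.H p + n s d p.1.1 p.1.2 - n s d p.1.2 p.1.1

/-- Virtual queues over time, initially empty, along channel states `s`, arrivals `A` and
decisions `D`. -/
def traj {Ω : Type*} (s : ℕ → Ω → Channel) (A : ℕ → Ω → Bool)
    (D : ℕ → Ω → Decision) : ℕ → Ω → State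
  | 0, _ => State.empty
  | t + 1, ω => step (s t ω) (D t ω) (A t ω) (traj s A D t ω)

/-- The links that may be scheduled: those that are ON and, unless empty queues may send fill
packets (`fill = true`), have a packet to send. -/
def Admissible (fill : Bool) (s : Channel) (x : State) (l : Link) : Prop :=
  l.tail.IsOn s l.head ∧ (fill = false → 0 < x.V l.tail)

/-- Weight `max {0, V u - V d}` of a link `u → d`. -/
def W (x : State) (l : Link) : ℤ := max 0 ((x.V l.tail : ℤ) - (x.V l.head : ℤ))

open Classical in
/-- `1` if `l` is ON and scheduled, else `0`. -/
noncomputable def mu (s : Channel) (d : Decision) (l : Link) : ℤ :=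
  if l.tail.IsOn s l.head ∧ d = some l then 1 else 0

/-- The quantity maximized by the back-pressure rule. -/
noncomputable def objective (s : Channel) (x : State) (d : Decision) : ℤ :=
  ∑ l : Link, W x l * mu s d l
    + ∑ p : Pair, x.H p * (n s d p.1.2 p.1.1 - n s d p.1.1 p.1.2)

/-- The back-pressure rule: schedule an admissible link that maximizes the objective.  If no
admissible link has a positive objective (the value of scheduling nothing is `0`), no link is
scheduled.  Other ties are broken arbitrarily. -/
def IsBackPressure (fill : Bool) (s : Channel) (x : State) : Decision → Prop
  | none => ∀ l, Admissible fill s x l → objective s x (some l) ≤ 0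
  | some l => Admissible fill s x l ∧ 0 < objective s x (some l) ∧
      ∀ l', Admissible fill s x l' → objective s x (some l') ≤ objective s x (some l)

/-- The transmission of packet `k` that corresponds to scheduling the link `l`. -/
def Link.transmission (l : Link) (k : ℕ) : Transmission :=
  match l.tail, l.head with
  | .source, .user i => .bs k (some i)
  | .user i, _ => .d2d i k
  | _, _ => .bs k none

/-- Real packet scheduling.  `pos k` is the virtual node at which packet `k` is.  If the link `u → d`
is scheduled, a packet at `u` is transmitted accordingly (nothing, if there is no such packet). -/
def Corresponds (pos : ℕ → Node) (num : ℕ) : Decision → Transmission → Prop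
  | none, T => T = .idle
  | some l, T => (∃ k < num, pos k = l.tail ∧ T = l.transmission k) ∨
      ((∀ k < num, pos k ≠ l.tail) ∧ T = .idle)

/-- The transmitted packet moves to the downstream node of the scheduled link. -/
def posStep (d : Decision) (T : Transmission) (pos : ℕ → Node) : ℕ → Node :=
  match d, T with
  | some l, .bs k _ => Function.update pos k l.head
  | some l, .d2d _ k => Function.update pos k l.head
  | _, _ => pos

/-- Virtual nodes of the packets over time; packets arrive at the source. -/
def posTraj {Ω : Type*} (D : ℕ → Ω → Decision) (T : ℕ → Ω → Transmission) : ℕ → Ω → ℕ → Node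
  | 0, _ => fun _ => .source
  | t + 1, ω => posStep (D t ω) (T t ω) (posTraj D T t ω)

section Stochastic

variable {Ω : Type*} [m : MeasurableSpace Ω]

/-- Channels and arrivals, with respect to a filtration `𝓖`, where `𝓖 t` is the information
available at the beginning of slot `t` (it may contain additional randomization).
The channel states are i.i.d. over time with law `ν`, the arrivals are i.i.d. over time with at most
one packet per slot and rate `lam`, and the two are independent. -/
structure IsModel (μ : Measure Ω) (ν : PMF Channel) (lam : ℝ) (𝓖 : Filtration ℕ m)
    (s : ℕ → Ω → Channel) (A : ℕ → Ω → Bool) : Prop where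
  measurable_channel : ∀ t, Measurable[𝓖 (t + 1)] (s t)
  measurable_arrival : ∀ t, Measurable[𝓖 (t + 1)] (A t)
  channel_law : ∀ t c, μ {ω | s t ω = c} = ν c
  arrival_law : ∀ t, μ.real {ω | A t ω = true} = lam
  channel_indep : ∀ t, Indep (𝓖 t) (MeasurableSpace.comap (s t) ⊤) μ
  arrival_indep : ∀ t,
    Indep (𝓖 t ⊔ MeasurableSpace.comap (s t) ⊤) (MeasurableSpace.comap (A t) ⊤) μ

/-- An on-line choice: what is done in slot `t` depends on the information at the beginning of the
slot and on the channel state of the slot, which is known before transmitting. -/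
def IsOnline {α : Type*} (𝓖 : Filtration ℕ m) (s : ℕ → Ω → Channel) (D : ℕ → Ω → α) : Prop :=
  ∀ t d, MeasurableSet[𝓖 t ⊔ MeasurableSpace.comap (s t) ⊤] {ω | D t ω = d}

/-- Stability of a queue: its time average expected length is finite,
`limsup_N (1/N) ∑_{t < N} E |Q t| < ∞`. -/
def Stable (μ : Measure Ω) (Q : ℕ → Ω → ℤ) : Prop :=
  limsup (fun N : ℕ =>
    (∑ t ∈ Finset.range N, ∫⁻ ω, ENNReal.ofReal |(Q t ω : ℝ)| ∂μ) / (N : ENNReal)) atTop < ⊤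

/-- Almost surely, the long-run averages of `f i j` and `f j i` agree, for any two users. -/
def Balanced (μ : Measure Ω) (f : Fin 3 → Fin 3 → ℕ → Ω → ℤ) : Prop :=
  ∀ i j : Fin 3, ∀ᵐ ω ∂μ, Tendsto
    (fun N : ℕ => ((∑ t ∈ Finset.range N, (f i j t ω - f j i t ω) : ℤ) : ℝ) / (N : ℝ))
    atTop (𝓝 0)

/-- An on-line transmission schedule of the network. -/
def IsSchedule (𝓖 : Filtration ℕ m) (s : ℕ → Ω → Channel) (A : ℕ → Ω → Bool)
    (T : ℕ → Ω → Transmission) : Prop :=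
  IsOnline 𝓖 s T ∧ ∀ t ω, (netTraj s A T t ω).Allowed (s t ω) (T t ω)

/-- The queue of the network is stable. -/
def QueueStable (μ : Measure Ω) (s : ℕ → Ω → Channel) (A : ℕ → Ω → Bool)
    (T : ℕ → Ω → Transmission) : Prop :=
  Stable μ (fun t ω => ((netTraj s A T t ω).backlog : ℤ))

/-- The equal-reciprocal constraint: in the long run, any two users share the same amount of content
with each other. -/
def EqualReciprocal (μ : Measure Ω) (s : ℕ → Ω → Channel) (A : ℕ → Ω → Bool)
    (T : ℕ → Ω → Transmission) : Prop :=
  Balanced μ (fun i j t ω => (netTraj s A T t ω).shared (T t ω) i j)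

/-- All queues of the nodes of the virtual network are stable. -/
def VirtualQueuesStable (μ : Measure Ω) (s : ℕ → Ω → Channel) (A : ℕ → Ω → Bool)
    (D : ℕ → Ω → Decision) : Prop :=
  ∀ u : Node, Stable μ (fun t ω => ((traj s A D t ω).V u : ℤ))

/-- All equal-reciprocal virtual queues are stable. -/
def ReciprocalQueuesStable (μ : Measure Ω) (s : ℕ → Ω → Channel)
    (A : ℕ → Ω → Bool) (D : ℕ → Ω → Decision) : Prop :=
  ∀ p : Pair, Stable μ (fun t ω => (traj s A D t ω).H p)

/-- The equal-reciprocal constraint in terms of the scheduled virtual links. -/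
def VirtualEqualReciprocal (μ : Measure Ω) (s : ℕ → Ω → Channel) (D : ℕ → Ω → Decision) : Prop :=
  Balanced μ (fun i j t ω => n (s t ω) (D t ω) i j)

/-- A run of the on-line algorithm: link decisions `D` by the back-pressure rule, and the
corresponding transmissions `T`, all chosen on-line. -/
structure IsAlgorithmRun (fill : Bool) (𝓖 : Filtration ℕ m) (s : ℕ → Ω → Channel)
    (A : ℕ → Ω → Bool) (D : ℕ → Ω → Decision) (T : ℕ → Ω → Transmission) : Prop where
  online_link : IsOnline 𝓖 s D
  online_packet : IsOnline 𝓖 s T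
  rule : ∀ t ω, IsBackPressure fill (s t ω) (traj s A D t ω) (D t ω)
  packet : ∀ t ω, Corresponds (posTraj D T t ω) (netTraj s A T t ω).num (D t ω) (T t ω)

end Stochastic

/-- The equal-reciprocal stability region: the arrival rates for which some on-line transmission
schedule keeps the queue stable and meets the equal-reciprocal constraint. -/
def stabilityRegion (ν : PMF Channel) : Set ℝ :=
  {lam | ∃ (Ω : Type) (m : MeasurableSpace Ω) (μ : Measure Ω) (𝓖 : Filtration ℕ m)
    (s : ℕ → Ω → Channel) (A : ℕ → Ω → Bool) (T : ℕ → Ω → Transmission),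
    IsProbabilityMeasure μ ∧ IsModel μ ν lam 𝓖 s A ∧ IsSchedule 𝓖 s A T ∧
    QueueStable μ s A T ∧ EqualReciprocal μ s A T}

end SocialGrouping

/-! The proof is a Lyapunov drift argument in which the comparison with an arbitrary stabilizing
schedule is made by weak duality, so that no stationary randomized policy has to be constructed.

Fix a state `x` of the virtual queues and read it as a price list. A packet is worth the queue of
its virtual node, plus, if a user holds it, the reciprocal queues weighted by the deliveries that
this user still owes (`packetPotential`). Whatever an allowed transmission does, the total value of
the packets, corrected for the arrival and for the deliveries between users, falls by at most the
largest gain of an ON link (`Network.potential_step_le`). Summed over time, averaged and divided by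
the elapsed time, the delivery terms vanish by the equal-reciprocal constraint. The remaining
potential is negligible along a subsequence because the backlog is stable. Hence every rate `lam'`
of the stability region satisfies `lam' * x.V source ≤ ∑ c, ν c * M c` whenever `M c` is nonnegative
and bounds the gains of all links ON in state `c` (`rate_mul_le_of_schedule`).

Back-pressure decisions supply such an `M`. Since `lam` is interior, some `lam' > lam` is available,
and the surplus gives a drift margin proportional to each queue (`exists_margin`). Two points need
care. The objective uses `max 0 (V u - V d)`, while the drift sees `V u - V d`; these differ only if
a packet is sent to a user whose queue exceeds that of the source, and then the always-ON links from
users to the destination force large gains anyway. Also, when the source is empty and fill packets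
are forbidden, the reciprocal queues cannot be served. Their margin is therefore claimed only for a
nonempty source, and is recovered from the fact that an arrival, independent of the past, makes the
source nonempty (`averageBounded_reciprocal`).

The drift bounds the time averages of the queues, and it bounds the second moments linearly in time.
With bounded increments the latter gives that all queues are `o(N)` almost surely
(`ae_tendsto_div_of_sq_integral_le`), hence the balance of the scheduled links. Finally, real
packets are tracked through the virtual network: real counts are at most the virtual queues, and
equal to them without fill packets. In that case the packets stored for sharing are either delivered
or pending, and the pending ones are `o(N)`. -/

namespace SocialGrouping

/-! ### Measurability for all subsets of the codomain -/

section Discrete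

variable {Ω α β γ : Type*}

/-- `X` is measurable with respect to `m` and the discrete σ-algebra of its codomain. -/
def DiscreteMeasurable (m : MeasurableSpace Ω) (X : Ω → α) : Prop :=
  ∀ S : Set α, MeasurableSet[m] (X ⁻¹' S)

namespace DiscreteMeasurable

variable {m m' : MeasurableSpace Ω} {X : Ω → α} {Y : Ω → β}

theorem of_countable [Countable α] (h : ∀ a, MeasurableSet[m] {ω | X ω = a}) :
    DiscreteMeasurable m X := by
  intro S
  have : X ⁻¹' S = ⋃ a ∈ S, {ω | X ω = a} := by ext ω; simp
  rw [this]
  exact MeasurableSet.biUnion (Set.to_countable S) fun a _ => h a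

theorem mono (h : DiscreteMeasurable m X) (hm : m ≤ m') : DiscreteMeasurable m' X :=
  fun S => hm _ (h S)

theorem const (a : α) : DiscreteMeasurable m (fun _ : Ω => a) := by
  intro S
  by_cases h : a ∈ S <;> simp [h]

theorem comp (h : DiscreteMeasurable m X) (f : α → β) : DiscreteMeasurable m (fun ω => f (X ω)) :=
  fun S => h (f ⁻¹' S)

/-- Splitting over the values of `Y` needs only one countable factor. This matters because `Network`
is uncountable, while channels, decisions, transmissions and arrivals are countable. -/
theorem map₂ [Countable β] (hX : DiscreteMeasurable m X) (hY : DiscreteMeasurable m Y)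
    (g : α → β → γ) : DiscreteMeasurable m (fun ω => g (X ω) (Y ω)) := by
  intro S
  have : (fun ω => g (X ω) (Y ω)) ⁻¹' S = ⋃ b, (Y ⁻¹' {b} ∩ X ⁻¹' ((fun a => g a b) ⁻¹' S)) := by
    ext ω; simp
  rw [this]
  exact MeasurableSet.iUnion fun b => (hY _).inter (hX _)

theorem measurable [MeasurableSpace α] (h : DiscreteMeasurable m X) : Measurable[m] X :=
  fun S _ => h S

theorem of_measurable [MeasurableSpace α] [DiscreteMeasurableSpace α] (h : Measurable[m] X) :
    DiscreteMeasurable m X :=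
  fun _ => h (MeasurableSet.of_discrete)

theorem integrable {μ : Measure[m] Ω} [IsFiniteMeasure μ] {X : Ω → ℝ}
    (h : DiscreteMeasurable m X) (C : ℝ) (hC : ∀ ω, |X ω| ≤ C) : Integrable X μ :=
  Integrable.of_bound h.measurable.aestronglyMeasurable C (ae_of_all _ hC)

end DiscreteMeasurable

end Discrete

/-! ### Independence, almost sure sublinear growth, averages of queues -/

section Probability

variable {Ω : Type*} [m : MeasurableSpace Ω] {μ : Measure Ω}

/-- The expectation of a product with the indicator of an independent event. -/
theorem integral_mul_indicator_of_indep [IsProbabilityMeasure μ] {m₁ m₂ : MeasurableSpace Ω}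
    (h₁ : m₁ ≤ m) (h₂ : m₂ ≤ m) (hind : Indep m₁ m₂ μ) {Z : Ω → ℝ} (hZ : Measurable[m₁] Z)
    {E : Set Ω} (hE : MeasurableSet[m₂] E) :
    ∫ ω, Z ω * E.indicator (fun _ => (1 : ℝ)) ω ∂μ = μ.real E * ∫ ω, Z ω ∂μ := by
  have hI : Measurable[m₂] (E.indicator (fun _ => (1 : ℝ))) := measurable_const.indicator hE
  have hif : IndepFun Z (E.indicator (fun _ => (1 : ℝ))) μ :=
    (IndepFun_iff_Indep _ _ _).2
      (indep_of_indep_of_le_left (indep_of_indep_of_le_right hind hI.comap_le) hZ.comap_le)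
  rw [hif.integral_fun_mul_eq_mul_integral (hZ.mono h₁ le_rfl).aestronglyMeasurable
    (hI.mono h₂ le_rfl).aestronglyMeasurable, integral_indicator_const _ (h₂ _ hE)]
  simp [mul_comm]

/-- A process with linearly bounded second moment and bounded increments is `o(N)` almost surely. -/
theorem ae_tendsto_div_of_sq_integral_le [IsFiniteMeasure μ] {Q : ℕ → Ω → ℝ} {B K : ℝ}
    (hQm : ∀ N, Measurable (Q N)) (hQi : ∀ N, Integrable (fun ω => Q N ω ^ 2) μ)
    (hQ : ∀ N, ∫ ω, Q N ω ^ 2 ∂μ ≤ B * N) (hinc : ∀ N ω, |Q (N + 1) ω - Q N ω| ≤ K) :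
    ∀ᵐ ω ∂μ, Tendsto (fun N : ℕ => Q N ω / N) atTop (𝓝 0) := by
  have hmeas : ∀ k : ℕ, Measurable fun ω => ENNReal.ofReal ((Q (k ^ 2) ω / (k ^ 2 : ℕ)) ^ 2) :=
    fun k => (((hQm _).div_const _).pow_const 2).ennreal_ofReal
  have hterm : ∀ k : ℕ, ∫⁻ ω, ENNReal.ofReal ((Q (k ^ 2) ω / (k ^ 2 : ℕ)) ^ 2) ∂μ
      ≤ ENNReal.ofReal (B * (1 / (k : ℝ) ^ 2)) := by
    intro k
    simp_rw [div_pow]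
    rw [← ofReal_integral_eq_lintegral_ofReal ((hQi _).div_const _)
      (ae_of_all _ fun ω => by positivity), integral_div]
    apply ENNReal.ofReal_le_ofReal
    rcases Nat.eq_zero_or_pos k with rfl | hk
    · simp
    have hk' : (0 : ℝ) < k := by exact_mod_cast hk
    rw [div_le_iff₀ (by positivity)]
    calc _ ≤ B * ((k ^ 2 : ℕ) : ℝ) := hQ _
      _ = _ := by push_cast; field_simp
  -- Along the squares the second moments of `Q N / N` are at most `B / k ^ 2`, which is summable.
  -- So almost surely the series of squares converges and its terms tend to zero.
  have hfin : ∫⁻ ω, ∑' k : ℕ, ENNReal.ofReal ((Q (k ^ 2) ω / (k ^ 2 : ℕ)) ^ 2) ∂μ ≠ ⊤ := by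
    rw [lintegral_tsum fun k => (hmeas k).aemeasurable]
    refine ne_top_of_le_ne_top ?_ (ENNReal.tsum_le_tsum hterm)
    exact ((Real.summable_one_div_nat_pow.2 one_lt_two).mul_left B).tsum_ofReal_ne_top
  have hK : ∀ ω N M, |Q (N + M) ω - Q N ω| ≤ K * M := by
    intro ω N M
    induction M with
    | zero => simp
    | succ M ih =>
      have := abs_le.1 (hinc (N + M) ω)
      have := abs_le.1 ih
      push_cast
      rw [← add_assoc]
      exact abs_le.2 ⟨by linarith, by linarith⟩
  filter_upwards [ae_lt_top (Measurable.tsum hmeas) hfin] with ω hω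
  have hK0 : 0 ≤ K := (abs_nonneg _).trans (hinc 0 ω)
  have h1 : Tendsto (fun k : ℕ => Q (k ^ 2) ω / (k ^ 2 : ℕ)) atTop (𝓝 0) := by
    have h2 := ENNReal.tendsto_atTop_zero_of_tsum_ne_top hω.ne
    have h3 := (ENNReal.tendsto_toReal ENNReal.zero_ne_top).comp h2
    have h4 := (Real.continuous_sqrt.tendsto 0).comp h3
    simp only [Real.sqrt_zero] at h4
    rw [tendsto_zero_iff_abs_tendsto_zero]
    refine h4.congr fun k => ?_
    simp only [Function.comp]
    rw [ENNReal.toReal_ofReal (by positivity), Real.sqrt_sq_eq_abs]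
  have hs : Tendsto Nat.sqrt atTop atTop := by
    refine tendsto_atTop.2 fun b => ?_
    filter_upwards [eventually_ge_atTop (b * b)] with a ha
    exact Nat.le_sqrt.2 ha
  have h5 : Tendsto (fun k : ℕ => |Q (k ^ 2) ω / (k ^ 2 : ℕ)| + 2 * K * ((k : ℝ))⁻¹) atTop (𝓝 0) := by
    have := h1.abs.add ((tendsto_inv_atTop_nhds_zero_nat (𝕜 := ℝ)).const_mul (2 * K))
    simpa using this
  refine squeeze_zero_norm' ?_ (h5.comp hs)
  filter_upwards [eventually_ge_atTop 1] with N hN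
  simp only [Function.comp, Real.norm_eq_abs]
  -- Between consecutive squares the index moves by at most `2 * k`, so bounded increments change `Q
  -- N / N` by at most `2 * K / k`.
  set k := N.sqrt with hk
  have hk0 : 0 < k := Nat.sqrt_pos.2 hN
  have hkR : (0 : ℝ) < k := by exact_mod_cast hk0
  obtain ⟨M, hM⟩ := Nat.exists_eq_add_of_le (Nat.sqrt_le' N)
  rw [← hk] at hM
  have hM2 : M ≤ 2 * k := by
    have := Nat.sqrt_le_add N
    rw [← hk] at this
    nlinarith
  have h6 := hK ω (k ^ 2) M
  rw [← hM] at h6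
  have hM2' : (M : ℝ) ≤ 2 * k := by exact_mod_cast hM2
  have hN' : ((k ^ 2 : ℕ) : ℝ) ≤ N := by exact_mod_cast (by omega : k ^ 2 ≤ N)
  have hk2 : (0 : ℝ) < (k ^ 2 : ℕ) := by exact_mod_cast (by positivity : 0 < k ^ 2)
  have h7 : |Q N ω| ≤ |Q (k ^ 2) ω| + 2 * K * k := by
    have h8 := abs_sub_abs_le_abs_sub (Q N ω) (Q (k ^ 2) ω)
    nlinarith
  calc |Q N ω / N| = |Q N ω| / N := by rw [abs_div, Nat.abs_cast]
    _ ≤ (|Q (k ^ 2) ω| + 2 * K * k) / (k ^ 2 : ℕ) := by gcongr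
    _ = _ := by
      rw [abs_div, Nat.abs_cast, add_div]
      congr 1
      push_cast
      field_simp

/-- The averages over time of the expected queue length are bounded. -/
def AverageBounded (μ : Measure Ω) (Q : ℕ → Ω → ℤ) : Prop :=
  ∃ C : NNReal, ∀ N : ℕ,
    ∑ t ∈ Finset.range N, ∫⁻ ω, ENNReal.ofReal |(Q t ω : ℝ)| ∂μ ≤ C * N

theorem AverageBounded.stable {Q : ℕ → Ω → ℤ} (h : AverageBounded μ Q) : Stable μ Q := by
  obtain ⟨C, hC⟩ := h
  refine lt_of_le_of_lt (limsup_le_of_le (a := (C : ENNReal)) (by isBoundedDefault) ?_)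
    ENNReal.coe_lt_top
  exact Eventually.of_forall fun N => ENNReal.div_le_of_le_mul (hC N)

theorem AverageBounded.of_integral {Q : ℕ → Ω → ℤ} {C : ℝ}
    (hi : ∀ t, Integrable (fun ω => (Q t ω : ℝ)) μ)
    (h : ∀ N : ℕ, ∑ t ∈ Finset.range N, ∫ ω, |(Q t ω : ℝ)| ∂μ ≤ C * N) : AverageBounded μ Q := by
  refine ⟨C.toNNReal, fun N => ?_⟩
  have h1 : ∀ t, ∫⁻ ω, ENNReal.ofReal |(Q t ω : ℝ)| ∂μ
      = ENNReal.ofReal (∫ ω, |(Q t ω : ℝ)| ∂μ) := fun t =>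
    (ofReal_integral_eq_lintegral_ofReal (hi t).abs (ae_of_all _ fun _ => abs_nonneg _)).symm
  simp_rw [h1]
  rw [← ENNReal.ofReal_sum_of_nonneg fun t _ => integral_nonneg fun _ => abs_nonneg _]
  refine (ENNReal.ofReal_le_ofReal (h N)).trans ?_
  rw [ENNReal.ofReal_mul' (Nat.cast_nonneg N), ENNReal.ofReal_natCast]
  rfl

theorem AverageBounded.of_le_sum {ι : Type*} [Fintype ι] {Q : ℕ → Ω → ℤ} {R : ι → ℕ → Ω → ℤ}
    (hR : ∀ i, AverageBounded μ (R i)) (hm : ∀ i t, Measurable (R i t))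
    (h : ∀ t ω, |Q t ω| ≤ ∑ i, |R i t ω|) : AverageBounded μ Q := by
  choose C hC using hR
  refine ⟨∑ i, C i, fun N => ?_⟩
  have hmR : ∀ i t, Measurable fun ω => ENNReal.ofReal |(R i t ω : ℝ)| := fun i t =>
    ((measurable_from_top (f := fun z : ℤ => |(z : ℝ)|)).comp (hm i t)).ennreal_ofReal
  calc ∑ t ∈ Finset.range N, ∫⁻ ω, ENNReal.ofReal |(Q t ω : ℝ)| ∂μ
      ≤ ∑ t ∈ Finset.range N, ∑ i, ∫⁻ ω, ENNReal.ofReal |(R i t ω : ℝ)| ∂μ := by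
        refine Finset.sum_le_sum fun t _ => ?_
        rw [← lintegral_finsetSum _ fun i _ => hmR i t]
        refine lintegral_mono fun ω => ?_
        dsimp only
        rw [← ENNReal.ofReal_sum_of_nonneg fun _ _ => abs_nonneg _]
        exact ENNReal.ofReal_le_ofReal (by exact_mod_cast h t ω)
    _ = ∑ i, ∑ t ∈ Finset.range N, ∫⁻ ω, ENNReal.ofReal |(R i t ω : ℝ)| ∂μ := Finset.sum_comm
    _ ≤ ∑ i, (C i : ENNReal) * N := Finset.sum_le_sum fun i _ => hC i N
    _ = _ := by rw [← Finset.sum_mul]; push_cast; rfl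

/-- A queue that is stable is infinitely often small compared with the time. -/
theorem Stable.frequently_integral_le {Q : ℕ → Ω → ℤ} (h : Stable μ Q)
    (hi : ∀ t, Integrable (fun ω => (Q t ω : ℝ)) μ) {δ : ℝ} (hδ : 0 < δ) :
    ∃ᶠ N : ℕ in atTop, ∫ ω, |(Q N ω : ℝ)| ∂μ ≤ δ * N := by
  have h1 : ∀ t, ∫⁻ ω, ENNReal.ofReal |(Q t ω : ℝ)| ∂μ
      = ENNReal.ofReal (∫ ω, |(Q t ω : ℝ)| ∂μ) := fun t =>
    (ofReal_integral_eq_lintegral_ofReal (hi t).abs (ae_of_all _ fun _ => abs_nonneg _)).symm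
  unfold Stable at h
  simp_rw [h1] at h
  obtain ⟨C, hC, hCtop⟩ := exists_between h
  have hev := eventually_lt_of_limsup_lt hC
  by_contra hcon
  rw [not_frequently] at hcon
  obtain ⟨N₀, hN₀⟩ := eventually_atTop.1 (hev.and hcon)
  have hpos : ∀ t, 0 ≤ ∫ ω, |(Q t ω : ℝ)| ∂μ := fun t => integral_nonneg fun _ => abs_nonneg _
  have hup : ∀ N, N₀ ≤ N → 0 < N → ∑ t ∈ Finset.range N, ∫ ω, |(Q t ω : ℝ)| ∂μ ≤ C.toReal * N := by
    intro N hN hN0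
    have h2 := (hN₀ N hN).1
    rw [← ENNReal.ofReal_sum_of_nonneg fun t _ => hpos t] at h2
    have h3 := (ENNReal.div_le_iff (by simp [hN0.ne']) (ENNReal.natCast_ne_top N)).1 h2.le
    have h4 := ENNReal.toReal_mono (ENNReal.mul_ne_top hCtop.ne (ENNReal.natCast_ne_top N)) h3
    rwa [ENNReal.toReal_ofReal (Finset.sum_nonneg fun t _ => hpos t), ENNReal.toReal_mul,
      ENNReal.toReal_natCast] at h4
  -- If the expected queue exceeded `δ * N` from some time on, its partial sums would grow
  -- quadratically, against the linear bound `hup`.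
  have hlow : ∀ K : ℕ, δ * N₀ * K + δ * K * (K - 1) / 2 ≤
      ∑ t ∈ Finset.range (N₀ + K), ∫ ω, |(Q t ω : ℝ)| ∂μ := by
    intro K
    induction K with
    | zero => simpa using Finset.sum_nonneg fun t _ => hpos t
    | succ K ih =>
      rw [← add_assoc, Finset.sum_range_succ]
      have := (hN₀ (N₀ + K) (by omega)).2
      push_cast at this ⊢
      nlinarith
  obtain ⟨K, hK⟩ := exists_nat_gt (max 1 (2 * (C.toReal * (N₀ + 1)) / δ + 1))
  have hK1 := (le_max_left _ _).trans_lt hK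
  have hK2 := (le_max_right _ _).trans_lt hK
  have h5 := (hlow K).trans (hup (N₀ + K) (by omega)
    (by have : 1 < K := by exact_mod_cast hK1
        omega))
  push_cast at h5
  have h6 : 2 * (C.toReal * (N₀ + 1)) < δ * (K - 1) := by
    rw [mul_comm δ, ← div_lt_iff₀ hδ]; linarith
  have hC0 : 0 ≤ C.toReal := ENNReal.toReal_nonneg
  have hN0 : (0 : ℝ) ≤ N₀ := Nat.cast_nonneg _
  have h7 : 2 * (C.toReal * (N₀ + 1)) * K < δ * (K - 1) * K := by
    apply mul_lt_mul_of_pos_right h6; linarith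
  have h8 : C.toReal * N₀ * 1 ≤ C.toReal * N₀ * K := by gcongr
  have h9 : 0 ≤ δ * N₀ * K := by positivity
  have h10 : 0 ≤ C.toReal * K := by positivity
  nlinarith

end Probability

/-! ### The network priced by the virtual queues -/

/-- The part of the objective that stems from the equal-reciprocal queues. -/
def reciprocalGain (s : Channel) (x : State) (d : Decision) : ℤ :=
  ∑ p : Pair, x.H p * (n s d p.1.2 p.1.1 - n s d p.1.1 p.1.2)

/-- The decrease, to first order, of half the sum of the squared queues under the decision `d`. -/
def gain (s : Channel) (x : State) : Decision → ℤ
  | none => 0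
  | some l => (x.V l.tail : ℤ) - x.V l.head + reciprocalGain s x (some l)

/-- A sum over all packets, when only packet `k₀` changes and at most one packet arrives. -/
theorem sum_range_add_of_eq_off {f f' : ℕ → ℤ} {N k₀ : ℕ} (hk₀ : k₀ < N)
    (h : ∀ k, k ≠ k₀ → f' k = f k) (a : Bool) :
    ∑ k ∈ Finset.range (N + if a = true then 1 else 0), f' k
      = ∑ k ∈ Finset.range N, f k + (f' k₀ - f k₀) + if a = true then f N else 0 := by
  have h1 : ∑ k ∈ Finset.range N, f' k = ∑ k ∈ Finset.range N, f k + (f' k₀ - f k₀) := by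
    rw [← sub_eq_iff_eq_add', ← Finset.sum_sub_distrib]
    rw [Finset.sum_eq_single_of_mem k₀ (Finset.mem_range.2 hk₀)]
    intro k _ hk
    rw [h k hk, sub_self]
  cases a
  · simp [h1]
  · simp [Finset.sum_range_succ, h1, h N hk₀.ne']

theorem sum_range_add (f : ℕ → ℤ) (N : ℕ) (a : Bool) :
    ∑ k ∈ Finset.range (N + if a = true then 1 else 0), f k
      = ∑ k ∈ Finset.range N, f k + if a = true then f N else 0 := by
  cases a
  · simp
  · simp [Finset.sum_range_succ]

/-- The virtual node of a packet that the users with `h i = true` have and whose holder is `o`. -/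
def packetNode (h : Channel) (o : Option (Fin 3)) : Node :=
  if h = fun _ => true then Node.dest
  else match o with
    | some i => .user i
    | none => if h = fun _ => false then .source else .status h

/-- `1` if user `i` is going to deliver the packet to user `j`. -/
def promised (h : Channel) (o : Option (Fin 3)) (i j : Fin 3) : ℤ :=
  if o = some i ∧ h j = false then 1 else 0

/-- The value of a packet when the queues of the virtual network are used as prices. -/
def packetPotential (x : State) (h : Channel) (o : Option (Fin 3)) : ℤ :=
  x.V (packetNode h o)
    + ∑ p : Pair, x.H p * (promised h o p.1.1 p.1.2 - promised h o p.1.2 p.1.1)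

def Network.potential (x : State) (y : Network) : ℤ :=
  ∑ k ∈ Finset.range y.num, packetPotential x (y.has k) (y.holder k)

/-- Packets that have not arrived have not been transmitted. -/
def Network.Fresh (y : Network) : Prop :=
  ∀ k, y.num ≤ k → y.has k = (fun _ => false) ∧ y.holder k = none

theorem packetPotential_full (x : State) (o : Option (Fin 3)) :
    packetPotential x (fun _ => true) o = x.V Node.dest := by
  simp [packetPotential, packetNode, promised]

theorem packetPotential_new (x : State) :
    packetPotential x (fun _ => false) none = x.V Node.source := by
  have : ¬ ((fun _ => false : Channel) = fun _ => true) := fun h => by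
    simpa using congrFun h 0
  simp [packetPotential, packetNode, promised, this]

theorem n_of_ne_user {s : Channel} {l : Link} (h : ∀ i, l.1 ≠ (Node.source, Node.user i))
    (i j : Fin 3) : n s (some l) i j = 0 := by
  simp [n, h]

theorem reciprocalGain_of_ne_user {s : Channel} {x : State} {l : Link}
    (h : ∀ i, l.1 ≠ (Node.source, Node.user i)) : reciprocalGain s x (some l) = 0 := by
  simp [reciprocalGain, n_of_ne_user h]

theorem n_source_user {s : Channel} {l : Link} {i : Fin 3} (h : l.1 = (Node.source, Node.user i))
    (a b : Fin 3) : n s (some l) a b = promised s (some i) a b := by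
  simp [n, promised, h]

theorem Network.shared_idle (y : Network) (a b : Fin 3) : y.shared .idle a b = 0 := by
  simp [Network.shared]

theorem Network.shared_bs (y : Network) (k : ℕ) (o : Option (Fin 3)) (a b : Fin 3) :
    y.shared (.bs k o) a b = 0 := by
  simp [Network.shared]

theorem Network.shared_d2d (y : Network) (i : Fin 3) (k : ℕ) (a b : Fin 3) :
    y.shared (.d2d i k) a b = promised (y.has k) (some i) a b := by
  have h : (∃ k', Transmission.d2d i k = .d2d a k' ∧ y.has k' b = false) ↔
      some i = some a ∧ y.has k b = false := by
    constructor
    · rintro ⟨k', h4, h5⟩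
      simp only [Transmission.d2d.injEq] at h4
      exact ⟨by rw [h4.1], by rw [h4.2]; exact h5⟩
    · rintro ⟨h4, h5⟩
      exact ⟨k, by rw [Option.some.inj h4], h5⟩
  simp only [Network.shared, promised, h]

theorem Network.Allowed.lt_num {s : Channel} {y : Network} {k : ℕ} {o : Option (Fin 3)}
    (h : y.Allowed s (.bs k o)) : k < y.num := by
  cases o
  · exact h.1
  · exact h.1

theorem Network.Fresh.step {y : Network} (hy : y.Fresh) {s : Channel} {T : Transmission}
    (hT : y.Allowed s T) (a : Bool) : (y.step s T a).Fresh := by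
  intro k hk
  have hk' : y.num ≤ k := by
    have : (y.step s T a).num = y.num + if a = true then 1 else 0 := rfl
    omega
  have := hy k hk'
  rcases T with _ | ⟨k₀, o⟩ | ⟨i, k₀⟩
  · exact this
  · have hne : k ≠ k₀ := (hT.lt_num.trans_le hk').ne'
    cases o <;> simpa [Network.step, Function.update_of_ne hne] using this
  · have hne : k ≠ k₀ := (lt_of_lt_of_le hT.1 hk').ne'
    simpa [Network.step, Function.update_of_ne hne] using this

/-- A broadcast without sharing moves the packet along a virtual link that is ON in state `s`,
unless it reaches no new user, in which case the potential is unchanged. Such a link has no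
reciprocal gain. -/
theorem packetPotential_broadcast_le {x : State} {s : Channel} {M : ℤ} (hM : 0 ≤ M)
    (hl : ∀ l : Link, l.tail.IsOn s l.head → gain s x (some l) ≤ M) (h : Channel) :
    packetPotential x h none - packetPotential x (fun j => h j || s j) none ≤ M := by
  have key : ∀ h' : Channel, packetPotential x h' none = x.V (packetNode h' none) := fun h' => by
    simp [packetPotential, promised]
  rw [key, key]
  have hlink : ∀ l : Link, l.tail.IsOn s l.head → (∀ i, l.1 ≠ (Node.source, Node.user i)) →
      (x.V l.tail : ℤ) - x.V l.head ≤ M := by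
    intro l h1 h2
    have := hl l h1
    rwa [gain, reciprocalGain_of_ne_user h2, add_zero] at this
  by_cases heq : (fun j => h j || s j) = h
  · rw [heq]; simpa using hM
  have hnot : h ≠ fun _ => true := by
    rintro rfl; exact heq (by simp)
  have hne0 : ¬ ((fun j => h j || s j) = fun _ => false) := by
    intro h0
    apply heq
    rw [h0]
    ext j
    have := congrFun h0 j
    simp only [Bool.or_eq_false_iff] at this
    simp [this.1]
  have hhead : packetNode (fun j => h j || s j) none = .status (fun j => h j || s j) := by
    unfold packetNode
    split_ifs with h1
    · rw [h1]; rfl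
    · rfl
  rw [hhead]
  by_cases h0 : h = fun _ => false
  · subst h0
    have htail : packetNode (fun _ => false) none = .source := by
      simp [packetNode, hnot]
    rw [htail]
    exact hlink ⟨(.source, .status _), trivial⟩ (fun i => by simp) (fun i => by simp)
  · have htail : packetNode h none = .status h := by
      simp [packetNode, hnot, h0]
    rw [htail]
    refine hlink ⟨(.status h, .status _), ?_, ?_⟩ ?_ (fun i => by simp)
    · exact fun h1 => heq h1.symm
    · intro i hi
      simp [hi]
    · intro i hi
      simp [hi]

/-- The deliveries promised at the moment of sharing are exactly those counted by `n`, so the loss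
of potential is the gain of the link from the source to user `i`. If all channels are ON, nothing is
left to share and the packet behaves as on the link from the source to the destination. -/
theorem packetPotential_share_le {x : State} {s : Channel} {M : ℤ}
    (hl : ∀ l : Link, l.tail.IsOn s l.head → gain s x (some l) ≤ M) {i : Fin 3} (hi : s i = true) :
    (x.V Node.source : ℤ) - packetPotential x s (some i) ≤ M := by
  by_cases hs : s = fun _ => true
  · subst hs
    rw [packetPotential_full]
    have := hl ⟨(.source, Node.dest), trivial⟩ (fun i => rfl)
    rwa [gain, reciprocalGain_of_ne_user (fun i => by simp [Node.dest]), add_zero] at this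
  · have := hl ⟨(.source, .user i), trivial⟩ hi
    refine le_trans (le_of_eq ?_) this
    rw [gain, reciprocalGain]
    simp only [n_source_user (l := ⟨(.source, .user i), trivial⟩) rfl]
    simp only [packetPotential, packetNode, hs, if_false, Link.tail, Link.head]
    rw [← sub_sub, sub_eq_add_neg, ← Finset.sum_neg_distrib]
    congr 1
    refine Finset.sum_congr rfl fun p _ => ?_
    ring

/-- The deliveries made cancel the promises contained in the potential. What remains is the queue of
the packet's node, which is bounded through the always-ON link from user `i` to the destination, or
is zero if the packet was already complete. -/
theorem packetPotential_deliver_le {x : State} {s : Channel} {M : ℤ} (hx : x.V Node.dest = 0)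
    (hM : 0 ≤ M) (hl : ∀ l : Link, l.tail.IsOn s l.head → gain s x (some l) ≤ M)
    (h : Channel) (i : Fin 3) :
    packetPotential x h (some i) + ∑ p : Pair, x.H p *
      (promised h (some i) p.1.2 p.1.1 - promised h (some i) p.1.1 p.1.2) ≤ M := by
  have : packetPotential x h (some i) + ∑ p : Pair, x.H p *
      (promised h (some i) p.1.2 p.1.1 - promised h (some i) p.1.1 p.1.2)
      = x.V (packetNode h (some i)) := by
    rw [packetPotential, add_assoc, ← Finset.sum_add_distrib]
    convert add_zero _
    refine Finset.sum_eq_zero fun p _ => ?_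
    ring
  rw [this]
  by_cases hh : h = fun _ => true
  · simp [packetNode, hh, hx, hM]
  · have := hl ⟨(.user i, Node.dest), rfl⟩ trivial
    rw [gain, reciprocalGain_of_ne_user (fun i => by simp)] at this
    simpa [packetNode, hh, Link.tail, Link.head, hx] using this

/-- The potential decreases in one slot by at most `M`, if all links that are ON have gain at
most `M`. -/
theorem Network.potential_step_le {x : State} {s : Channel} {M : ℤ} (hx : x.V Node.dest = 0)
    (hM : 0 ≤ M) (hl : ∀ l : Link, l.tail.IsOn s l.head → gain s x (some l) ≤ M)
    {y : Network} (hy : y.Fresh) {T : Transmission} (hT : y.Allowed s T) (a : Bool) :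
    y.potential x - (y.step s T a).potential x + x.V Node.source * (if a = true then 1 else 0)
      + ∑ p : Pair, x.H p * (y.shared T p.1.2 p.1.1 - y.shared T p.1.1 p.1.2) ≤ M := by
  -- An arriving packet adds exactly the source price, which cancels the arrival term.
  have hnew : packetPotential x (y.has y.num) (y.holder y.num) = x.V Node.source := by
    rw [(hy _ le_rfl).1, (hy _ le_rfl).2, packetPotential_new]
  have hite : (x.V Node.source : ℤ) * (if a = true then 1 else 0)
      = if a = true then packetPotential x (y.has y.num) (y.holder y.num) else 0 := by
    rw [hnew]; simp
  rw [hite]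
  rcases T with _ | ⟨k, _ | i⟩ | ⟨i, k⟩
  · have h1 : (y.step s .idle a).potential x = _ :=
      sum_range_add (fun k => packetPotential x (y.has k) (y.holder k)) y.num a
    rw [h1]
    simpa [Network.shared_idle, Network.potential] using hM
  · have h1 : (y.step s (.bs k none) a).potential x = _ :=
      sum_range_add_of_eq_off (f := fun k => packetPotential x (y.has k) (y.holder k))
        hT.1 (fun j hj => by simp [Network.step, Function.update_of_ne hj]) a
    have h2 := packetPotential_broadcast_le hM hl (y.has k)
    rw [h1]
    simp only [Network.shared_bs, sub_self, mul_zero, Finset.sum_const_zero, add_zero, Network.potential,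
      Network.step, Function.update_self, hT.2]
    linarith
  · have h1 : (y.step s (.bs k (some i)) a).potential x = _ :=
      sum_range_add_of_eq_off (f := fun k => packetPotential x (y.has k) (y.holder k))
        hT.1 (fun j hj => by simp [Network.step, Function.update_of_ne hj]) a
    have h2 := packetPotential_share_le hl hT.2.2.2
    have h3 : y.has k = fun _ => false := funext hT.2.2.1
    rw [h1]
    simp only [Network.shared_bs, sub_self, mul_zero, Finset.sum_const_zero, add_zero, Network.potential,
      Network.step, Function.update_self, hT.2.1, h3, Bool.false_or, packetPotential_new]
    linarith
  · have h1 : (y.step s (.d2d i k) a).potential x = _ :=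
      sum_range_add_of_eq_off (f := fun k => packetPotential x (y.has k) (y.holder k))
        hT.1 (fun j hj => by simp [Network.step, Function.update_of_ne hj]) a
    have h2 := packetPotential_deliver_le hx hM hl (y.has k) i
    rw [h1]
    simp only [Network.shared_d2d, Network.potential, Network.step, Function.update_self, hT.2,
      packetPotential_full, hx]
    push_cast
    linarith

instance : Countable Transmission := by
  let f : Transmission → Option ((ℕ × Option (Fin 3)) ⊕ (Fin 3 × ℕ)) := fun
    | .idle => none
    | .bs k o => some (.inl (k, o))
    | .d2d i k => some (.inr (i, k))
  refine Function.Injective.countable (f := f) ?_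
  rintro (_ | ⟨k, o⟩ | ⟨i, k⟩) (_ | ⟨k', o'⟩ | ⟨i', k'⟩) h <;> simp_all [f]

/-! ### Weak duality along a sample path -/

section Pathwise

variable {Ω : Type*} {s : ℕ → Ω → Channel} {A : ℕ → Ω → Bool} {T : ℕ → Ω → Transmission}

theorem netTraj_num_le (t : ℕ) (ω : Ω) : (netTraj s A T t ω).num ≤ t := by
  induction t with
  | zero => exact le_rfl
  | succ t ih =>
    simp only [netTraj, Network.step]
    split_ifs <;> omega

theorem Network.backlog_le_num (y : Network) : y.backlog ≤ y.num :=
  (Finset.card_filter_le _ _).trans (Finset.card_range _).le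

theorem netTraj_fresh (hT : ∀ t ω, (netTraj s A T t ω).Allowed (s t ω) (T t ω)) (t : ℕ) (ω : Ω) :
    (netTraj s A T t ω).Fresh := by
  induction t with
  | zero => exact fun k _ => ⟨rfl, rfl⟩
  | succ t ih => exact ih.step (hT t ω) _

theorem Network.shared_mem (y : Network) (τ : Transmission) (i j : Fin 3) :
    0 ≤ y.shared τ i j ∧ y.shared τ i j ≤ 1 := by
  unfold Network.shared
  split_ifs <;> simp

/-- For fixed prices only finitely many packet values occur, and packets that everybody has are
worth nothing. -/
theorem exists_potential_le (x : State) (hx : x.V Node.dest = 0) :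
    ∃ C : ℕ, ∀ y : Network, y.potential x ≤ C * y.backlog := by
  let C := ∑ z : Channel × Option (Fin 3), (packetPotential x z.1 z.2).natAbs
  refine ⟨C, fun y => ?_⟩
  have hC : ∀ h o, packetPotential x h o ≤ C := by
    intro h o
    have h1 := Finset.single_le_sum
      (f := fun z : Channel × Option (Fin 3) => (packetPotential x z.1 z.2).natAbs)
      (fun _ _ => Nat.zero_le _) (Finset.mem_univ (h, o))
    have h2 : (packetPotential x h o).natAbs ≤ C := h1
    omega
  clear_value C
  unfold Network.potential Network.backlog
  rw [Finset.card_filter, Nat.cast_sum, Finset.mul_sum]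
  refine Finset.sum_le_sum fun k _ => ?_
  split_ifs with h
  · simpa using hC _ _
  · push Not at h
    have : y.has k = fun _ => true := funext fun i => by simpa using h i
    rw [this, packetPotential_full, hx]
    simp

theorem sum_gain_le (hT : ∀ t ω, (netTraj s A T t ω).Allowed (s t ω) (T t ω)) {x : State}
    (hx : x.V Node.dest = 0) {M : Channel → ℤ} (hM : ∀ c, 0 ≤ M c)
    (hl : ∀ c (l : Link), l.tail.IsOn c l.head → gain c x (some l) ≤ M c) (N : ℕ) (ω : Ω) :
    x.V Node.source * ∑ t ∈ Finset.range N, (if A t ω = true then (1 : ℤ) else 0)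
      + ∑ p : Pair, x.H p * ∑ t ∈ Finset.range N,
        ((netTraj s A T t ω).shared (T t ω) p.1.2 p.1.1
          - (netTraj s A T t ω).shared (T t ω) p.1.1 p.1.2)
      ≤ ∑ t ∈ Finset.range N, M (s t ω) + (netTraj s A T N ω).potential x := by
  induction N with
  | zero => simp [netTraj, Network.empty, Network.potential]
  | succ N ih =>
    have h1 := Network.potential_step_le hx (hM (s N ω)) (hl (s N ω)) (netTraj_fresh hT N ω)
      (hT N ω) (A N ω)
    simp only [Finset.sum_range_succ, mul_add, Finset.sum_add_distrib] at ih h1 ⊢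
    have h2 : netTraj s A T (N + 1) ω = (netTraj s A T N ω).step (s N ω) (T N ω) (A N ω) := rfl
    rw [h2]
    linarith

end Pathwise

/-! ### Weak duality for arrival rates -/

section Model

variable {Ω : Type*} [m : MeasurableSpace Ω] {μ : Measure Ω} {ν : PMF Channel} {lam : ℝ}
  {𝓖 : Filtration ℕ m} {s : ℕ → Ω → Channel} {A : ℕ → Ω → Bool}

namespace IsModel

theorem discreteMeasurable_channel (h : IsModel μ ν lam 𝓖 s A) (t : ℕ) :
    DiscreteMeasurable (𝓖 (t + 1)) (s t) :=
  .of_measurable (h.measurable_channel t)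

theorem discreteMeasurable_arrival (h : IsModel μ ν lam 𝓖 s A) (t : ℕ) :
    DiscreteMeasurable (𝓖 (t + 1)) (A t) :=
  .of_measurable (h.measurable_arrival t)

theorem sup_comap_le (h : IsModel μ ν lam 𝓖 s A) (t : ℕ) :
    𝓖 t ⊔ MeasurableSpace.comap (s t) ⊤ ≤ 𝓖 (t + 1) := by
  refine sup_le (𝓖.mono (Nat.le_succ t)) ?_
  rintro _ ⟨S, -, rfl⟩
  exact h.discreteMeasurable_channel t S

/-- Conditioning on the finitely many channel states: the indicator of each is independent of `X`,
which is known at the beginning of the slot. -/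
theorem integral_channel [IsProbabilityMeasure μ] (h : IsModel μ ν lam 𝓖 s A) {t : ℕ}
    {α : Type*} {X : Ω → α} (hX : DiscreteMeasurable (𝓖 t) X) (f : α → Channel → ℝ)
    (hf : ∀ c, ∃ C, ∀ ω, |f (X ω) c| ≤ C) :
    ∫ ω, f (X ω) (s t ω) ∂μ = ∑ c, (ν c).toReal * ∫ ω, f (X ω) c ∂μ := by
  have hsm : ∀ c, MeasurableSet {ω | s t ω = c} := fun c =>
    𝓖.le _ _ (h.discreteMeasurable_channel t {c})
  have h1 : ∀ ω, f (X ω) (s t ω)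
      = ∑ c, f (X ω) c * {ω | s t ω = c}.indicator (fun _ => (1 : ℝ)) ω := by
    intro ω
    rw [Finset.sum_eq_single (s t ω)]
    · simp
    · intro c _ hc
      simp [Set.indicator, hc.symm]
    · simp
  simp_rw [h1]
  rw [integral_finsetSum]
  · refine Finset.sum_congr rfl fun c _ => ?_
    rw [integral_mul_indicator_of_indep (E := {ω | s t ω = c}) (𝓖.le t)
      (by rintro _ ⟨S, -, rfl⟩; exact 𝓖.le _ _ (h.discreteMeasurable_channel t S))
      (h.channel_indep t) (hX.comp fun a => f a c).measurable ⟨{c}, trivial, rfl⟩, measureReal_def,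
      h.channel_law]
  · intro c _
    obtain ⟨C, hC⟩ := hf c
    have hi : Integrable (fun ω => f (X ω) c) μ :=
      ((hX.comp fun a => f a c).mono (𝓖.le t)).integrable C hC
    refine (hi.indicator (hsm c)).congr (ae_of_all _ fun ω => ?_)
    by_cases hω : s t ω = c <;> simp [Set.indicator, hω]

theorem integral_arrival [IsProbabilityMeasure μ] (h : IsModel μ ν lam 𝓖 s A) {t : ℕ}
    {X : Ω → ℝ} (hX : DiscreteMeasurable (𝓖 t ⊔ MeasurableSpace.comap (s t) ⊤) X) :
    ∫ ω, X ω * (if A t ω = true then 1 else 0) ∂μ = lam * ∫ ω, X ω ∂μ := by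
  rw [← h.arrival_law t, ← integral_mul_indicator_of_indep (E := {ω | A t ω = true})
    ((h.sup_comap_le t).trans (𝓖.le _))
    (by rintro _ ⟨S, -, rfl⟩; exact 𝓖.le _ _ (h.discreteMeasurable_arrival t S))
    (h.arrival_indep t) hX.measurable ⟨{true}, trivial, rfl⟩]
  simp only [Set.indicator, Set.mem_ofPred_eq]

theorem rate_nonneg (h : IsModel μ ν lam 𝓖 s A) : 0 ≤ lam :=
  h.arrival_law 0 ▸ measureReal_nonneg

theorem rate_le_one [IsProbabilityMeasure μ] (h : IsModel μ ν lam 𝓖 s A) : lam ≤ 1 :=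
  h.arrival_law 0 ▸ measureReal_le_one

end IsModel

variable {T : ℕ → Ω → Transmission}

theorem DiscreteMeasurable.of_online {α : Type*} [Countable α] {D : ℕ → Ω → α}
    (hD : IsOnline 𝓖 s D) (t : ℕ) :
    DiscreteMeasurable (𝓖 t ⊔ MeasurableSpace.comap (s t) ⊤) (D t) :=
  .of_countable (hD t)

theorem netTraj_discreteMeasurable (h : IsModel μ ν lam 𝓖 s A) (hT : IsOnline 𝓖 s T) (t : ℕ) :
    DiscreteMeasurable (𝓖 t) (netTraj s A T t) := by
  induction t with
  | zero => exact .const _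
  | succ t ih =>
    have h1 := ih.mono (𝓖.mono (Nat.le_succ t))
    have h2 := (DiscreteMeasurable.of_online hT t).mono (h.sup_comap_le t)
    exact ((((h1.map₂ (h.discreteMeasurable_channel t) Prod.mk).map₂ h2 Prod.mk).map₂
      (h.discreteMeasurable_arrival t) Prod.mk)).comp
        fun z => z.1.1.1.step z.1.1.2 z.1.2 z.2

/-- Weak duality: if the gains of all links that are ON are bounded by `M`, then any arrival rate
that can be supported is bounded correspondingly. -/
theorem rate_mul_le_of_schedule [IsProbabilityMeasure μ] (h : IsModel μ ν lam 𝓖 s A)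
    (hT : IsSchedule 𝓖 s A T) (hQ : QueueStable μ s A T) (hE : EqualReciprocal μ s A T)
    {x : State} (hx : x.V Node.dest = 0) {M : Channel → ℤ} (hM : ∀ c, 0 ≤ M c)
    (hl : ∀ c (l : Link), l.tail.IsOn c l.head → gain c x (some l) ≤ M c) :
    lam * x.V Node.source ≤ ∑ c, (ν c).toReal * M c := by
  have hnet := netTraj_discreteMeasurable h hT.1
  have hb : ∀ t, Integrable (fun ω => (((netTraj s A T t ω).backlog : ℤ) : ℝ)) μ := by
    intro t
    refine (((hnet t).comp fun y => ((y.backlog : ℤ) : ℝ)).mono (𝓖.le t)).integrable t fun ω => ?_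
    have := (Network.backlog_le_num _).trans (netTraj_num_le (s := s) (A := A) (T := T) t ω)
    simpa using this
  have hA : ∀ t, ∫ ω, ((if A t ω = true then (1 : ℤ) else 0 : ℤ) : ℝ) ∂μ = lam := by
    intro t
    have := h.integral_arrival (t := t) (X := fun _ => 1) (.const _)
    simpa using this
  have hAi : ∀ t, Integrable (fun ω => ((if A t ω = true then (1 : ℤ) else 0 : ℤ) : ℝ)) μ := by
    intro t
    refine (((h.discreteMeasurable_arrival t).comp
      fun a => ((if a = true then (1 : ℤ) else 0 : ℤ) : ℝ)).mono (𝓖.le _)).integrable 1 fun ω => ?_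
    split_ifs <;> simp
  have hMi : ∀ t, Integrable (fun ω => (M (s t ω) : ℝ)) μ := by
    intro t
    refine (((h.discreteMeasurable_channel t).comp
      fun c => (M c : ℝ)).mono (𝓖.le _)).integrable (∑ c, (M c : ℝ)) fun ω => ?_
    rw [abs_of_nonneg (by exact_mod_cast hM _)]
    exact Finset.single_le_sum (f := fun c => (M c : ℝ)) (fun c _ => by exact_mod_cast hM c)
      (Finset.mem_univ _)
  have hMint : ∀ t, ∫ ω, (M (s t ω) : ℝ) ∂μ = ∑ c, (ν c).toReal * M c := by
    intro t
    have := h.integral_channel (t := t) (X := fun _ => ()) (.const _) (fun _ c => (M c : ℝ))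
      (fun c => ⟨|(M c : ℝ)|, fun _ => le_rfl⟩)
    simpa using this
  let S : Pair → ℕ → Ω → ℝ := fun p N ω => ((∑ t ∈ Finset.range N,
        ((netTraj s A T t ω).shared (T t ω) p.1.2 p.1.1
          - (netTraj s A T t ω).shared (T t ω) p.1.1 p.1.2) : ℤ) : ℝ)
  have hSbound : ∀ p N ω, |S p N ω| ≤ N := by
    intro p N ω
    simp only [S]
    rw [← Int.cast_abs]
    have : |∑ t ∈ Finset.range N, ((netTraj s A T t ω).shared (T t ω) p.1.2 p.1.1
          - (netTraj s A T t ω).shared (T t ω) p.1.1 p.1.2)| ≤ ∑ t ∈ Finset.range N, 1 := by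
      refine (Finset.abs_sum_le_sum_abs _ _).trans (Finset.sum_le_sum fun t _ => ?_)
      have h1 := (netTraj s A T t ω).shared_mem (T t ω) p.1.2 p.1.1
      have h2 := (netTraj s A T t ω).shared_mem (T t ω) p.1.1 p.1.2
      exact abs_le.2 ⟨by linarith, by linarith⟩
    simp only [Finset.sum_const, Finset.card_range, nsmul_eq_mul, mul_one] at this
    exact_mod_cast this
  have hSm : ∀ p N, Measurable (S p N) := by
    intro p N
    simp only [S, Int.cast_sum]
    refine Finset.measurable_sum _ fun t _ => ?_
    exact ((((hnet t).mono (𝓖.le t)).map₂ ((DiscreteMeasurable.of_online hT.1 t).mono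
      ((h.sup_comap_le t).trans (𝓖.le _))) fun y τ =>
        ((y.shared τ p.1.2 p.1.1 - y.shared τ p.1.1 p.1.2 : ℤ) : ℝ))).measurable
  have hSi : ∀ p N, Integrable (S p N) μ := fun p N =>
    Integrable.of_bound (hSm p N).aestronglyMeasurable N (ae_of_all _ (hSbound p N))
  -- The equal-reciprocal constraint is almost sure; dominated convergence, with bound `1`, turns it
  -- into convergence of the means.
  have hSlim : ∀ p, Tendsto (fun N : ℕ => (∫ ω, S p N ω ∂μ) / N) atTop (𝓝 0) := by
    intro p
    have h1 := tendsto_integral_of_dominated_convergence (μ := μ) (F := fun (N : ℕ) ω => S p N ω / N)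
      (f := fun _ => 0) (fun _ => 1) (fun N => ((hSm p N).div_const _).aestronglyMeasurable)
      (integrable_const _) (fun N => ae_of_all _ fun ω => by
        rw [Real.norm_eq_abs, abs_div, Nat.abs_cast]
        exact div_le_one_of_le₀ (hSbound p N ω) (Nat.cast_nonneg _)) (hE p.1.2 p.1.1)
    simpa [integral_div] using h1
  obtain ⟨C, hC⟩ := exists_potential_le x hx
  have hmain : ∀ N : ℕ, lam * x.V Node.source * N + ∑ p : Pair, x.H p * ∫ ω, S p N ω ∂μ
      ≤ N * ∑ c, (ν c).toReal * M c
        + C * ∫ ω, |(((netTraj s A T N ω).backlog : ℤ) : ℝ)| ∂μ := by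
    intro N
    have h1 : ∀ ω, (x.V Node.source : ℝ) * ∑ t ∈ Finset.range N,
        ((if A t ω = true then (1 : ℤ) else 0 : ℤ) : ℝ) + ∑ p : Pair, x.H p * S p N ω
        ≤ ∑ t ∈ Finset.range N, (M (s t ω) : ℝ)
          + C * |(((netTraj s A T N ω).backlog : ℤ) : ℝ)| := by
      intro ω
      have h2 := (sum_gain_le hT.2 hx hM hl N ω).trans (add_le_add_right (hC _) _)
      rw [abs_of_nonneg (by positivity)]
      have h3 := (Int.cast_le (R := ℝ)).2 h2
      simp only [S]
      push_cast at h3 ⊢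
      exact h3
    have h3 : Integrable (fun ω => ∑ p : Pair, (x.H p : ℝ) * S p N ω) μ :=
      integrable_finsetSum _ fun p _ => (hSi p N).const_mul _
    have h4 : Integrable (fun ω => (x.V Node.source : ℝ) * ∑ t ∈ Finset.range N,
        ((if A t ω = true then (1 : ℤ) else 0 : ℤ) : ℝ)) μ :=
      (integrable_finsetSum _ fun t _ => hAi t).const_mul _
    have h5 : Integrable (fun ω => ∑ t ∈ Finset.range N, (M (s t ω) : ℝ)) μ :=
      integrable_finsetSum _ fun t _ => hMi t
    have h6 := (hb N).abs.const_mul (C : ℝ)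
    have h7 := integral_mono (h4.add h3) (h5.add h6) h1
    simp only [Pi.add_apply] at h7
    rw [integral_add h4 h3, integral_add h5 h6, integral_const_mul, integral_const_mul,
      integral_finsetSum _ fun t _ => hAi t, integral_finsetSum _ fun t _ => hMi t,
      integral_finsetSum _ fun p _ => (hSi p N).const_mul _] at h7
    simp only [hA, hMint, integral_const_mul, Finset.sum_const, Finset.card_range,
      nsmul_eq_mul] at h7
    linarith
  refine le_of_forall_pos_le_add fun ε hε => ?_
  have hlim : Tendsto (fun N : ℕ => ∑ p : Pair, x.H p * ((∫ ω, S p N ω ∂μ) / N)) atTop (𝓝 0) := by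
    have := tendsto_finsetSum Finset.univ fun p _ => (hSlim p).const_mul (x.H p : ℝ)
    simpa using this
  have hev := hlim.eventually (lt_mem_nhds (show -(ε / 2) < 0 by linarith))
  -- Stability controls only time averages, so the terminal potential is small merely for infinitely
  -- many `N`; one such `N` is enough. The `+ 1` allows for `C = 0`.
  have hfr := hQ.frequently_integral_le hb (δ := ε / 2 / (C + 1)) (by positivity)
  obtain ⟨N, h1, h2, h3⟩ := (hfr.and_eventually (hev.and (eventually_gt_atTop 0))).exists
  have hN : (0 : ℝ) < N := by exact_mod_cast h3
  have h4 := hmain N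
  have h5 : (C : ℝ) * (ε / 2 / (C + 1) * N) ≤ ε / 2 * N := by
    have : (C : ℝ) / (C + 1) ≤ 1 := by rw [div_le_one (by positivity)]; linarith
    calc (C : ℝ) * (ε / 2 / (C + 1) * N) = (C / (C + 1)) * (ε / 2 * N) := by ring
      _ ≤ 1 * (ε / 2 * N) := by gcongr
      _ = _ := one_mul _
  have h6 : (C : ℝ) * ∫ ω, |(((netTraj s A T N ω).backlog : ℤ) : ℝ)| ∂μ ≤ ε / 2 * N :=
    (mul_le_mul_of_nonneg_left h1 (Nat.cast_nonneg _)).trans h5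
  have h7 : ∑ p : Pair, x.H p * ∫ ω, S p N ω ∂μ
      = (∑ p : Pair, x.H p * ((∫ ω, S p N ω ∂μ) / N)) * N := by
    rw [Finset.sum_mul]
    refine Finset.sum_congr rfl fun p _ => ?_
    field_simp
  rw [h7] at h4
  have h8 : -(ε / 2) * N ≤ (∑ p : Pair, x.H p * ((∫ ω, S p N ω ∂μ) / N)) * N := by gcongr
  refine le_of_mul_le_mul_right ?_ hN
  linarith

end Model

/-- Weak duality for the rates of the equal-reciprocal stability region. -/
theorem rate_mul_le_of_mem_stabilityRegion {ν : PMF Channel} {lam : ℝ}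
    (h : lam ∈ stabilityRegion ν) {x : State} (hx : x.V Node.dest = 0) {M : Channel → ℤ}
    (hM : ∀ c, 0 ≤ M c)
    (hl : ∀ c (l : Link), l.tail.IsOn c l.head → gain c x (some l) ≤ M c) :
    lam * x.V Node.source ≤ ∑ c, (ν c).toReal * M c := by
  obtain ⟨Ω, m, μ, 𝓖, s, A, T, _, h1, h2, h3, h4⟩ := h
  exact rate_mul_le_of_schedule h1 h2 h3 h4 hx hM hl

theorem exists_gt_mem_stabilityRegion {ν : PMF Channel} {lam : ℝ}
    (h : lam ∈ interior (stabilityRegion ν)) : ∃ lam' ∈ stabilityRegion ν, lam < lam' := by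
  obtain ⟨ε, hε, hball⟩ := Metric.isOpen_iff.1 isOpen_interior lam h
  refine ⟨lam + ε / 2, interior_subset (hball ?_), by linarith⟩
  rw [Metric.mem_ball, Real.dist_eq, add_sub_cancel_left, abs_of_pos (by linarith)]
  linarith

theorem mem_Icc_of_mem_stabilityRegion {ν : PMF Channel} {lam : ℝ}
    (h : lam ∈ stabilityRegion ν) : 0 ≤ lam ∧ lam ≤ 1 := by
  obtain ⟨Ω, m, μ, 𝓖, s, A, T, _, h1, -⟩ := h
  exact ⟨h1.rate_nonneg, h1.rate_le_one⟩

theorem pos_of_mem_interior_stabilityRegion {ν : PMF Channel} {lam : ℝ}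
    (h : lam ∈ interior (stabilityRegion ν)) : 0 < lam := by
  obtain ⟨ε, hε, hball⟩ := Metric.isOpen_iff.1 isOpen_interior lam h
  have h1 : lam - ε / 2 ∈ stabilityRegion ν := by
    refine interior_subset (hball ?_)
    rw [Metric.mem_ball, Real.dist_eq, sub_sub_cancel_left, abs_neg, abs_of_pos (by linarith)]
    linarith
  have := (mem_Icc_of_mem_stabilityRegion h1).1
  linarith

/-! ### Objective, gain and margin of back-pressure decisions -/

theorem objective_none (s : Channel) (x : State) : objective s x none = 0 := by
  simp [objective, mu, n]

theorem objective_some {s : Channel} {x : State} {l : Link} (h : l.tail.IsOn s l.head) :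
    objective s x (some l) = W x l + reciprocalGain s x (some l) := by
  unfold objective
  congr 1
  rw [Finset.sum_eq_single l]
  · simp [mu, h]
  · intro l' _ hl'
    simp [mu, hl'.symm]
  · simp

theorem gain_le_objective {s : Channel} {x : State} {l : Link} (h : l.tail.IsOn s l.head) :
    gain s x (some l) ≤ objective s x (some l) := by
  rw [objective_some h]
  exact add_le_add_left (le_max_right _ _) _

theorem IsBackPressure.objective_nonneg {fill : Bool} {s : Channel} {x : State} {d : Decision}
    (h : IsBackPressure fill s x d) : 0 ≤ objective s x d := by
  cases d with
  | none => rw [objective_none]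
  | some l => exact h.2.1.le

theorem IsBackPressure.le_objective {fill : Bool} {s : Channel} {x : State} {d : Decision}
    (h : IsBackPressure fill s x d) {l : Link} (hl : Admissible fill s x l) :
    objective s x (some l) ≤ objective s x d := by
  cases d with
  | none => rw [objective_none]; exact h l hl
  | some l' => exact h.2.2 l hl

/-- The gain of a back-pressure decision is its objective, unless a packet is moved to a user whose
queue is longer than the queue of the source. -/
theorem IsBackPressure.gain_eq {fill : Bool} {s : Channel} {x : State} {d : Decision}
    (h : IsBackPressure fill s x d) :
    gain s x d = objective s x d ∨ ∃ (i : Fin 3) (l : Link), d = some l ∧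
      x.V Node.source < x.V (.user i) ∧ objective s x d = reciprocalGain s x d ∧
      gain s x d = objective s x d - x.V (.user i) + x.V Node.source := by
  cases d with
  | none => left; rw [objective_none]; rfl
  | some l =>
    have hon := h.1.1
    have hpos := h.2.1
    by_cases hle : x.V l.head ≤ x.V l.tail
    · left
      rw [objective_some hon, gain, W, max_eq_right]
      have : (x.V l.head : ℤ) ≤ x.V l.tail := by exact_mod_cast hle
      linarith
    · push Not at hle
      have hle' : (x.V l.tail : ℤ) < x.V l.head := by exact_mod_cast hle
      have hW : W x l = 0 := max_eq_left (by linarith)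
      by_cases hu : ∀ i, l.1 ≠ (Node.source, Node.user i)
      · rw [objective_some hon, reciprocalGain_of_ne_user hu, hW] at hpos
        simp at hpos
      · push Not at hu
        obtain ⟨i, hi⟩ := hu
        have h1 : l.tail = .source := congrArg Prod.fst hi
        have h2 : l.head = .user i := congrArg Prod.snd hi
        have h3 : objective s x (some l) = reciprocalGain s x (some l) := by
          rw [objective_some hon, hW, zero_add]
        refine Or.inr ⟨i, l, rfl, ?_, h3, ?_⟩
        · rwa [h1, h2] at hle
        · rw [h3, gain, h1, h2]
          ring

theorem Node.isLink_dest {u : Node} (hu : u ≠ Node.dest) : u.IsLink Node.dest := by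
  rcases u with _ | i | r
  · trivial
  · rfl
  · exact ⟨fun h => hu (by rw [h]; rfl), fun _ _ => rfl⟩

/-- The link from `u` to the destination is a competitor of weight `V u` without reciprocal gain. If
it is inadmissible because `u` is empty, the bound is trivial. -/
theorem IsBackPressure.le_objective_of_isOn_dest {fill : Bool} {s : Channel} {x : State}
    {d : Decision} (hx : x.V Node.dest = 0) (h : IsBackPressure fill s x d) {u : Node}
    (hu : u ≠ Node.dest) (hon : u.IsOn s Node.dest) : (x.V u : ℤ) ≤ objective s x d := by
  rcases Nat.eq_zero_or_pos (x.V u) with h0 | h0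
  · rw [h0]; exact h.objective_nonneg
  · let l : Link := ⟨(u, Node.dest), Node.isLink_dest hu⟩
    refine le_trans (le_of_eq ?_) (h.le_objective (l := l) ⟨hon, fun _ => h0⟩)
    rw [objective_some (l := l) hon, reciprocalGain_of_ne_user (fun i => by simp [l, Node.dest]), W]
    simp [l, Link.tail, Link.head, hx]

theorem IsBackPressure.queue_user_le {fill : Bool} {s : Channel} {x : State} {d : Decision}
    (hx : x.V Node.dest = 0) (h : IsBackPressure fill s x d) (i : Fin 3) :
    (x.V (.user i) : ℤ) ≤ objective s x d :=
  h.le_objective_of_isOn_dest hx (by simp [Node.dest]) trivial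

theorem IsBackPressure.queue_le {fill : Bool} {x : State} {d : Decision}
    (hx : x.V Node.dest = 0) (h : IsBackPressure fill (fun _ => true) x d) (u : Node) :
    (x.V u : ℤ) ≤ objective (fun _ => true) x d := by
  by_cases hu : u = Node.dest
  · rw [hu, hx]; exact h.objective_nonneg
  · refine h.le_objective_of_isOn_dest hx hu ?_
    rcases u with _ | i | r
    · exact fun _ => rfl
    · trivial
    · exact fun _ _ => rfl

theorem reciprocalGain_all_on (x : State) (d : Decision) :
    reciprocalGain (fun _ => true) x d = 0 := by
  simp [reciprocalGain, n]

/-- The value of telling user `i` to share a packet that only user `j` misses. -/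
theorem exists_channel_abs_le_objective (fill : Bool) {x : State} (hs : 0 < x.V Node.source)
    (p : Pair) : ∃ c, ∀ d, IsBackPressure fill c x d → |x.H p| ≤ objective c x d := by
  have key : ∀ i j : Fin 3, i ≠ j → ∀ d, IsBackPressure fill (Function.update (fun _ => true) j false)
      x d → ∑ q : Pair, x.H q * ((if q.1.2 = i ∧ q.1.1 = j then 1 else 0)
        - (if q.1.1 = i ∧ q.1.2 = j then 1 else 0))
        ≤ objective (Function.update (fun _ => true) j false) x d := by
    intro i j hij d hd
    let l : Link := ⟨(.source, .user i), trivial⟩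
    have hon : l.tail.IsOn (Function.update (fun _ => true) j false) l.head := by
      show Function.update (fun _ => true) j false i = true
      simp [hij]
    refine le_trans ?_ (hd.le_objective (l := l) ⟨hon, fun _ => hs⟩)
    rw [objective_some hon]
    refine le_trans (le_of_eq ?_) (le_add_of_nonneg_left (le_max_left _ _))
    unfold reciprocalGain
    refine Finset.sum_congr rfl fun q _ => ?_
    have hc : ∀ b : Fin 3, Function.update (fun _ : Fin 3 => true) j false b = false ↔ b = j := by
      intro b
      by_cases hb : b = j <;> simp [hb]
    rw [n_source_user (l := l) rfl, n_source_user (l := l) rfl]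
    simp only [promised, hc, Option.some.injEq, eq_comm (a := i)]
  obtain ⟨⟨a, b⟩, hab⟩ := p
  simp only at hab
  -- The sign of the reciprocal queue decides which user of the pair should share and which one
  -- should miss the packet.
  rcases le_total 0 (x.H ⟨(a, b), hab⟩) with h0 | h0
  · refine ⟨_, fun d hd => le_trans (le_of_eq ?_) (key b a hab.ne' d hd)⟩
    rw [abs_of_nonneg h0, Finset.sum_eq_single ⟨(a, b), hab⟩]
    · simp [hab.ne]
    · rintro ⟨⟨a', b'⟩, hab'⟩ _ hne
      have h1 : ¬ (b' = b ∧ a' = a) := fun h => hne (by simp [h.1, h.2])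
      have h2 : ¬ (a' = b ∧ b' = a) := by
        rintro ⟨rfl, rfl⟩; exact lt_asymm hab hab'
      simp [h1, h2]
    · simp
  · refine ⟨_, fun d hd => le_trans (le_of_eq ?_) (key a b hab.ne d hd)⟩
    rw [abs_of_nonpos h0, Finset.sum_eq_single ⟨(a, b), hab⟩]
    · simp [hab.ne]
    · rintro ⟨⟨a', b'⟩, hab'⟩ _ hne
      have h1 : ¬ (a' = a ∧ b' = b) := fun h => hne (by simp [h.1, h.2])
      have h2 : ¬ (b' = a ∧ a' = b) := by
        rintro ⟨rfl, rfl⟩; exact lt_asymm hab hab'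
      simp [h1, h2]
    · simp

theorem sum_toReal_eq_one (ν : PMF Channel) : ∑ c, (ν c).toReal = 1 := by
  have h := ν.tsum_coe
  rw [tsum_fintype] at h
  rw [← ENNReal.toReal_sum fun c _ => ν.apply_ne_top c, h]
  rfl

theorem exists_pos_le_toReal {ν : PMF Channel} (hν : ∀ c, ν c ≠ 0) :
    ∃ κ > 0, ∀ c, κ ≤ (ν c).toReal := by
  obtain ⟨c₀, -, h⟩ := Finset.exists_min_image Finset.univ (fun c => (ν c).toReal)
    Finset.univ_nonempty
  exact ⟨_, ENNReal.toReal_pos (hν c₀) (ν.apply_ne_top c₀), fun c => h c (Finset.mem_univ c)⟩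

/-- Weak duality with the back-pressure objectives as bounds. Links with an empty tail may be
inadmissible. If the source is nonempty, such a link does not start there, so its gain has no
reciprocal part and is nonpositive. -/
theorem source_rate_le_of_gain_eq {fill : Bool} {ν : PMF Channel} {lam : ℝ}
    (h : lam ∈ stabilityRegion ν) {x : State} (hx : x.V Node.dest = 0) {d : Channel → Decision}
    (hd : ∀ c, IsBackPressure fill c x (d c)) :
    lam * x.V Node.source ≤ ∑ c, (ν c).toReal * (objective c x (d c) : ℝ) := by
  rcases Nat.eq_zero_or_pos (x.V Node.source) with h0 | h0
  · rw [h0, Nat.cast_zero, mul_zero]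
    exact Finset.sum_nonneg fun c _ =>
      mul_nonneg ENNReal.toReal_nonneg (by exact_mod_cast (hd c).objective_nonneg)
  · refine rate_mul_le_of_mem_stabilityRegion h hx (fun c => (hd c).objective_nonneg) ?_
    intro c l hon
    rcases Nat.eq_zero_or_pos (x.V l.tail) with h1 | h1
    · have hu : ∀ i, l.1 ≠ (Node.source, Node.user i) := by
        intro i hi
        have : l.tail = .source := congrArg Prod.fst hi
        rw [this] at h1
        omega
      rw [gain, reciprocalGain_of_ne_user hu, h1]
      refine le_trans ?_ (hd c).objective_nonneg
      simp
    · exact (gain_le_objective hon).trans ((hd c).le_objective ⟨hon, fun _ => h1⟩)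

section

variable {fill : Bool} {x : State} {d : Channel → Decision}

/-- The objective is at least every user queue, since these can always be served. If gain and
objective differ, the loss is `V (user i') - V source` for the receiving user `i'`, which leaves at
least `V source`. -/
theorem source_le_gain (hx : x.V Node.dest = 0) (hd : ∀ c, IsBackPressure fill c x (d c))
    {i : Fin 3} (hi : x.V Node.source < x.V (.user i)) (c : Channel) :
    (x.V Node.source : ℤ) ≤ gain c x (d c) := by
  rcases (hd c).gain_eq with h | ⟨i', l, -, h1, -, h3⟩
  · have := (hd c).queue_user_le hx i
    rw [h]; omega
  · have := (hd c).queue_user_le hx i'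
    rw [h3]; omega

/-- With all channels ON every node other than the destination can send to it, and no reciprocal
gain is possible. The exceptional case of `IsBackPressure.gain_eq` would then make the objective
zero, although it is at least a positive user queue. -/
theorem queue_le_gain_all_on (hx : x.V Node.dest = 0) (hd : ∀ c, IsBackPressure fill c x (d c))
    (u : Node) : (x.V u : ℤ) ≤ gain (fun _ => true) x (d fun _ => true) := by
  rcases (hd fun _ => true).gain_eq with h | ⟨i', l, -, h1, h2, -⟩
  · rw [h]; exact (hd _).queue_le hx u
  · have := (hd fun _ => true).queue_user_le hx i'
    rw [h2, reciprocalGain_all_on] at this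
    omega

end

/-- The expected gain of the back-pressure rule exceeds the expected work that arrives, by a margin
proportional to the queues. -/
theorem exists_margin (fill : Bool) {ν : PMF Channel} (hν : ∀ c, ν c ≠ 0) {lam : ℝ}
    (hlam : lam ∈ interior (stabilityRegion ν)) :
    ∃ κ > (0 : ℝ), ∀ (x : State) (d : Channel → Decision), x.V Node.dest = 0 →
      (∀ c, IsBackPressure fill c x (d c)) →
      (∀ u, lam * x.V Node.source + κ * x.V u ≤ ∑ c, (ν c).toReal * (gain c x (d c) : ℝ)) ∧
      (0 < x.V Node.source → ∀ p, lam * x.V Node.source + κ * |(x.H p : ℝ)|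
        ≤ ∑ c, (ν c).toReal * (gain c x (d c) : ℝ)) := by
  obtain ⟨lam', hlam', hlt⟩ := exists_gt_mem_stabilityRegion hlam
  have hpos := pos_of_mem_interior_stabilityRegion hlam
  have hle1 := (mem_Icc_of_mem_stabilityRegion hlam').2
  obtain ⟨κ₀, hκ₀, hκν⟩ := exists_pos_le_toReal hν
  -- Weight of the duality bound for `lam'` in a convex combination; the remaining weight `1 - θ`
  -- pays for the margin.
  set θ := lam / lam' with hθ
  have hlam'0 : 0 < lam' := hpos.trans hlt
  have hθ0 : 0 < θ := div_pos hpos hlam'0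
  have hθ1 : θ < 1 := (div_lt_one hlam'0).2 hlt
  have hθlam : θ * lam' = lam := div_mul_cancel₀ _ hlam'0.ne'
  -- This constant serves the case of a user queue above the source queue, where the slack comes
  -- from `lam < 1` instead of from duality.
  set κ₂ := min (1 - lam) κ₀ with hκ₂
  have hκ₂0 : 0 < κ₂ := lt_min (by linarith) hκ₀
  have hκ₂a : κ₂ ≤ 1 - lam := min_le_left _ _
  have hκ₂b : κ₂ ≤ κ₀ := min_le_right _ _
  set κ₃ := κ₀ * κ₂ / (κ₂ + 2 * κ₀) with hκ₃
  have hκ₃0 : 0 < κ₃ := by positivity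
  set κ := min ((1 - θ) * κ₀) (min κ₂ κ₃) with hκ
  have hκ0 : 0 < κ := lt_min (mul_pos (by linarith) hκ₀) (lt_min hκ₂0 hκ₃0)
  have hκa : κ ≤ (1 - θ) * κ₀ := min_le_left _ _
  have hκb : κ ≤ κ₂ := (min_le_right _ _).trans (min_le_left _ _)
  have hκc : κ ≤ κ₃ := (min_le_right _ _).trans (min_le_right _ _)
  refine ⟨κ, hκ0, fun x d hx hd => ?_⟩
  have hw0 : ∀ c, 0 ≤ (ν c).toReal := fun c => ENNReal.toReal_nonneg
  set F := ∑ c, (ν c).toReal * (gain c x (d c) : ℝ) with hF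
  have hVs : (0 : ℝ) ≤ x.V Node.source := Nat.cast_nonneg _
  by_cases hbad : ∃ i, x.V Node.source < x.V (.user i)
  · obtain ⟨i, hi⟩ := hbad
    have hs : ∀ c, (x.V Node.source : ℝ) ≤ gain c x (d c) := fun c => by
      exact_mod_cast source_le_gain hx hd hi c
    -- All gains are at least the source queue here, so the mean gain is the source queue plus
    -- nonnegative excesses, of which a single channel state may be kept.
    have hFc : ∀ c, x.V Node.source
        + (ν c).toReal * ((gain c x (d c) : ℝ) - x.V Node.source) ≤ F := by
      intro c
      have h1 : F = x.V Node.source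
          + ∑ c, (ν c).toReal * ((gain c x (d c) : ℝ) - x.V Node.source) := by
        simp only [mul_sub, Finset.sum_sub_distrib, ← Finset.sum_mul, sum_toReal_eq_one]
        ring
      rw [h1]
      gcongr
      exact Finset.single_le_sum
        (f := fun c => (ν c).toReal * ((gain c x (d c) : ℝ) - x.V Node.source))
        (fun c _ => mul_nonneg (hw0 c) (sub_nonneg.2 (hs c))) (Finset.mem_univ c)
    have hFs : (x.V Node.source : ℝ) ≤ F :=
      (le_add_of_nonneg_right (mul_nonneg (hw0 _) (sub_nonneg.2 (hs fun _ => true)))).trans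
        (hFc fun _ => true)
    have hκ₀F : ∀ c, ∀ a : ℝ, a ≤ gain c x (d c) →
        x.V Node.source + κ₀ * (a - x.V Node.source) ≤ F := by
      intro c a ha
      refine le_trans ?_ (hFc c)
      have h1 : κ₀ * (a - x.V Node.source)
          ≤ κ₀ * ((gain c x (d c) : ℝ) - x.V Node.source) := by gcongr
      have h2 : κ₀ * ((gain c x (d c) : ℝ) - x.V Node.source)
          ≤ (ν c).toReal * ((gain c x (d c) : ℝ) - x.V Node.source) :=
        mul_le_mul_of_nonneg_right (hκν c) (sub_nonneg.2 (hs c))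
      linarith
    have hu : ∀ u, lam * x.V Node.source + κ₂ * x.V u ≤ F := by
      intro u
      have h1 := hκ₀F (fun _ => true) (x.V u) (by exact_mod_cast queue_le_gain_all_on hx hd u)
      have h2 : κ₂ * x.V Node.source ≤ (1 - lam) * x.V Node.source := by gcongr
      rcases le_total (x.V u : ℝ) (x.V Node.source) with h3 | h3
      · have : κ₂ * x.V u ≤ κ₂ * x.V Node.source := by gcongr
        linarith
      · have : κ₂ * ((x.V u : ℝ) - x.V Node.source) ≤ κ₀ * ((x.V u : ℝ) - x.V Node.source) :=
          mul_le_mul_of_nonneg_right hκ₂b (sub_nonneg.2 h3)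
        linarith
    refine ⟨fun u => le_trans ?_ (hu u), fun hs0 p => ?_⟩
    · gcongr
    · obtain ⟨c, hc⟩ := exists_channel_abs_le_objective fill hs0 p
      have h1 : ∃ i', |x.H p| - x.V (.user i') ≤ gain c x (d c) := by
        have h2 := hc _ (hd c)
        rcases (hd c).gain_eq with h3 | ⟨i', l, -, -, -, h3⟩
        · exact ⟨0, by rw [h3]; omega⟩
        · exact ⟨i', by rw [h3]; omega⟩
      obtain ⟨i', h1⟩ := h1
      have h2 := hκ₀F c (|(x.H p : ℝ)| - x.V (.user i')) (by exact_mod_cast h1)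
      have h3 := hu (.user i')
      have h4 := hu .source
      have h5 : lam * x.V Node.source + κ₃ * |(x.H p : ℝ)| ≤ F := by
        have h6 : 0 < κ₂ + 2 * κ₀ := by positivity
        have h7 : κ₃ * (κ₂ + 2 * κ₀) = κ₀ * κ₂ := div_mul_cancel₀ _ h6.ne'
        -- The three bounds `h2`, `h3`, `h4` are added with weights `κ₂`, `κ₀`, `κ₀`. The queues of
        -- `i'` and of the source cancel and `κ₀ * κ₂ * |H p|` remains, which dictates the value of
        -- `κ₃`.
        refine le_of_mul_le_mul_right ?_ h6
        have h8 : lam * x.V Node.source ≤ x.V Node.source := by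
          have : lam ≤ 1 := by linarith
          nlinarith
        have h9 := mul_le_mul_of_nonneg_left h2 hκ₂0.le
        have h10 := mul_le_mul_of_nonneg_left h3 hκ₀.le
        have h11 := mul_le_mul_of_nonneg_left h4 hκ₀.le
        have h12 := mul_le_mul_of_nonneg_left h8 hκ₂0.le
        have h13 : κ₃ * |(x.H p : ℝ)| * (κ₂ + 2 * κ₀) = κ₀ * κ₂ * |(x.H p : ℝ)| := by
          rw [← h7]; ring
        rw [add_mul, h13]
        linarith
      refine le_trans ?_ h5
      gcongr
  · push Not at hbad
    have hg : ∀ c, gain c x (d c) = objective c x (d c) := by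
      intro c
      rcases (hd c).gain_eq with h | ⟨i, l, -, h1, -⟩
      · exact h
      · exact absurd h1 (hbad i).not_gt
    have hnn : ∀ c, (0 : ℝ) ≤ gain c x (d c) := fun c => by
      rw [hg c]; exact_mod_cast (hd c).objective_nonneg
    have hFs : lam' * x.V Node.source ≤ F := by
      rw [hF]
      simp only [hg]
      exact source_rate_le_of_gain_eq hlam' hx hd
    have hκ₀F : ∀ c, ∀ a : ℝ, a ≤ gain c x (d c) → κ₀ * a ≤ F := by
      intro c a ha
      calc κ₀ * a ≤ κ₀ * gain c x (d c) := by gcongr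
        _ ≤ (ν c).toReal * gain c x (d c) := mul_le_mul_of_nonneg_right (hκν c) (hnn c)
        _ ≤ F := Finset.single_le_sum (f := fun c => (ν c).toReal * (gain c x (d c) : ℝ))
          (fun c _ => mul_nonneg (hw0 c) (hnn c)) (Finset.mem_univ c)
    have hcomb : ∀ a : ℝ, 0 ≤ a → κ₀ * a ≤ F → lam * x.V Node.source + κ * a ≤ F := by
      intro a ha h
      have h1 : κ * a ≤ (1 - θ) * κ₀ * a := by gcongr
      have h2 := mul_le_mul_of_nonneg_left h (sub_nonneg.2 hθ1.le)
      have h3 := mul_le_mul_of_nonneg_left hFs hθ0.le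
      rw [← mul_assoc, hθlam] at h3
      linarith
    refine ⟨fun u => hcomb _ (Nat.cast_nonneg _) (hκ₀F (fun _ => true) _ ?_), fun hs0 p => ?_⟩
    · exact_mod_cast queue_le_gain_all_on hx hd u
    · obtain ⟨c, hc⟩ := exists_channel_abs_le_objective fill hs0 p
      refine hcomb _ (abs_nonneg _) (hκ₀F c _ ?_)
      rw [hg c]
      exact_mod_cast hc _ (hd c)

theorem exists_isBackPressure (fill : Bool) (s : Channel) (x : State) :
    ∃ d, IsBackPressure fill s x d := by
  by_cases h : ∃ l, Admissible fill s x l ∧ 0 < objective s x (some l)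
  · obtain ⟨l₀, h₀⟩ := h
    obtain ⟨l, hl, hmax⟩ := Set.exists_max_image {l | Admissible fill s x l}
      (fun l => objective s x (some l)) (Set.toFinite _) ⟨l₀, h₀.1⟩
    exact ⟨some l, hl, h₀.2.trans_le (hmax l₀ h₀.1), hmax⟩
  · push Not at h
    exact ⟨none, h⟩

/-- The least gain of a back-pressure decision. -/
theorem exists_min_gain (fill : Bool) (s : Channel) (x : State) :
    ∃ d, IsBackPressure fill s x d ∧ ∀ d', IsBackPressure fill s x d' → gain s x d ≤ gain s x d' :=
  Set.exists_min_image {d | IsBackPressure fill s x d} (gain s x) (Set.toFinite _)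
    (exists_isBackPressure fill s x)

/-! ### Quadratic Lyapunov function and its one-slot drift -/

/-- The sum of the squared queues. -/
def State.lyapunov (x : State) : ℤ := ∑ u, (x.V u : ℤ) ^ 2 + ∑ p, x.H p ^ 2

/-- A bound for the second-order terms of the drift. -/
def driftBound : ℕ := 5 * Fintype.card Node + Fintype.card Pair

theorem n_mem (s : Channel) (d : Decision) (i j : Fin 3) : 0 ≤ n s d i j ∧ n s d i j ≤ 1 := by
  unfold n
  split_ifs <;> simp

theorem gain_eq_sum (s : Channel) (x : State) (d : Decision) :
    gain s x d = ∑ u, (x.V u : ℤ) * ((if d.map Link.tail = some u then 1 else 0)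
      - (if d.map Link.head = some u then 1 else 0)) + reciprocalGain s x d := by
  cases d with
  | none => simp [gain, reciprocalGain, n]
  | some l => simp [gain, mul_sub]

theorem lyapunov_step_le (s : Channel) (d : Decision) (a : Bool) {x : State}
    (hx : x.V Node.dest = 0) :
    (step s d a x).lyapunov ≤ x.lyapunov + driftBound
      + 2 * (x.V Node.source * (if a = true then 1 else 0) - gain s x d) := by
  -- Truncation at zero is harmless: for an empty queue the cross term vanishes and the new length
  -- is at most `2`. Otherwise the queue changes by at most `2`, so `5` covers the square.
  have hV : ∀ u, ((step s d a x).V u : ℤ) ^ 2 ≤ (x.V u : ℤ) ^ 2 + 5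
      + 2 * (x.V u * ((if u = Node.source ∧ a = true then 1 else 0)
        - ((if d.map Link.tail = some u then 1 else 0)
        - (if d.map Link.head = some u then 1 else 0)))) := by
    intro u
    by_cases hu : u = Node.dest
    · subst hu
      simp [step, hx]
    · simp only [step, if_neg hu]
      rcases Nat.eq_zero_or_pos (x.V u) with h0 | h0
      · rw [h0]
        split_ifs <;> simp
      · obtain ⟨k, hk⟩ := Nat.exists_eq_add_of_le' h0
        rw [hk]
        split_ifs <;> push_cast [Nat.add_sub_cancel] <;> nlinarith
  have hH : ∀ p, (step s d a x).H p ^ 2 ≤ x.H p ^ 2 + 1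
      - 2 * (x.H p * (n s d p.1.2 p.1.1 - n s d p.1.1 p.1.2)) := by
    intro p
    have h1 := n_mem s d p.1.1 p.1.2
    have h2 := n_mem s d p.1.2 p.1.1
    simp only [step]
    nlinarith
  have h1 : (x.V Node.source : ℤ) * (if a = true then 1 else 0)
      = ∑ u, (x.V u : ℤ) * (if u = Node.source ∧ a = true then 1 else 0) := by
    rw [Finset.sum_eq_single Node.source]
    · simp
    · intro u _ hu
      simp [hu]
    · simp
  have h2 := Finset.sum_le_sum fun u (_ : u ∈ Finset.univ) => hV u
  have h3 := Finset.sum_le_sum fun p (_ : p ∈ Finset.univ) => hH p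
  rw [gain_eq_sum, h1, State.lyapunov, State.lyapunov, driftBound, reciprocalGain]
  simp only [Finset.sum_add_distrib, Finset.sum_sub_distrib, ← Finset.mul_sum, mul_sub,
    Finset.sum_const, Finset.card_univ, nsmul_eq_mul] at h2 h3 ⊢
  push_cast
  linarith

theorem step_dest (s : Channel) (d : Decision) (a : Bool) (x : State) :
    (step s d a x).V Node.dest = 0 := by
  simp [step]

theorem step_source_pos (s : Channel) (d : Decision) (x : State) :
    0 < (step s d true x).V Node.source := by
  simp [step, Node.dest]

theorem abs_step_V_sub_le (s : Channel) (d : Decision) (a : Bool) {x : State}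
    (hx : x.V Node.dest = 0) (u : Node) : |((step s d a x).V u : ℤ) - x.V u| ≤ 2 := by
  by_cases hu : u = Node.dest
  · rw [hu, step_dest, hx]; simp
  · simp only [step, if_neg hu]
    rw [abs_le]
    split_ifs <;> constructor <;> omega

theorem abs_step_H_sub_le (s : Channel) (d : Decision) (a : Bool) (x : State) (p : Pair) :
    |(step s d a x).H p - x.H p| ≤ 1 := by
  have h1 := n_mem s d p.1.1 p.1.2
  have h2 := n_mem s d p.1.2 p.1.1
  simp only [step]
  rw [abs_le]
  constructor <;> linarith

section Pathwise

variable {Ω : Type*} {s : ℕ → Ω → Channel} {A : ℕ → Ω → Bool} {D : ℕ → Ω → Decision}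

theorem traj_dest (t : ℕ) (ω : Ω) : (traj s A D t ω).V Node.dest = 0 := by
  cases t with
  | zero => rfl
  | succ t => exact step_dest _ _ _ _

/-- Each slot has finitely many inputs, so finitely many states are reachable by time `t`. Hence
every function of the state is bounded at each fixed time. -/
theorem finite_range_traj (t : ℕ) : (Set.range (traj s A D t)).Finite := by
  induction t with
  | zero => exact (Set.finite_singleton State.empty).subset (by rintro _ ⟨ω, rfl⟩; rfl)
  | succ t ih =>
    refine (((Set.finite_univ (α := Channel × Decision × Bool)).prod ih).image
      fun z => step z.1.1 z.1.2.1 z.1.2.2 z.2).subset ?_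
    rintro _ ⟨ω, rfl⟩
    exact ⟨((s t ω, D t ω, A t ω), traj s A D t ω), ⟨trivial, ω, rfl⟩, rfl⟩

theorem exists_abs_le_traj (f : State → ℝ) (t : ℕ) :
    ∃ C, ∀ ω, |f (traj s A D t ω)| ≤ C := by
  obtain ⟨C, hC⟩ := ((finite_range_traj (s := s) (A := A) (D := D) t).image
    fun x => |f x|).bddAbove
  exact ⟨C, fun ω => hC ⟨_, ⟨ω, rfl⟩, rfl⟩⟩

theorem traj_H_eq_sum (p : Pair) (N : ℕ) (ω : Ω) :
    (traj s A D N ω).H p = ∑ t ∈ Finset.range N,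
      (n (s t ω) (D t ω) p.1.1 p.1.2 - n (s t ω) (D t ω) p.1.2 p.1.1) := by
  induction N with
  | zero => rfl
  | succ N ih => rw [Finset.sum_range_succ, ← ih, ← add_sub_assoc]; rfl

end Pathwise

/-! ### Expected drift, stability and almost sure balance -/

section Model

variable {Ω : Type*} [m : MeasurableSpace Ω] {μ : Measure Ω} {ν : PMF Channel} {lam : ℝ}
  {𝓖 : Filtration ℕ m} {s : ℕ → Ω → Channel} {A : ℕ → Ω → Bool} {D : ℕ → Ω → Decision}
  {fill : Bool}

theorem traj_discreteMeasurable (h : IsModel μ ν lam 𝓖 s A) (hD : IsOnline 𝓖 s D) (t : ℕ) :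
    DiscreteMeasurable (𝓖 t) (traj s A D t) := by
  induction t with
  | zero => exact .const _
  | succ t ih =>
    have h1 := ih.mono (𝓖.mono (Nat.le_succ t))
    have h2 := (DiscreteMeasurable.of_online hD t).mono (h.sup_comap_le t)
    exact ((((h1.map₂ (h.discreteMeasurable_channel t) Prod.mk).map₂ h2 Prod.mk).map₂
      (h.discreteMeasurable_arrival t) Prod.mk)).comp
        fun z => step z.1.1.2 z.1.2 z.2 z.1.1.1

variable [IsProbabilityMeasure μ]

theorem integrable_traj (h : IsModel μ ν lam 𝓖 s A) (hD : IsOnline 𝓖 s D) (f : State → ℝ)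
    (t : ℕ) : Integrable (fun ω => f (traj s A D t ω)) μ := by
  obtain ⟨C, hC⟩ := exists_abs_le_traj (s := s) (A := A) (D := D) f t
  exact (((traj_discreteMeasurable h hD t).comp f).mono (𝓖.le t)).integrable C hC

/-- The drift of the sum of the squared queues. -/
theorem integral_lyapunov_succ_le (h : IsModel μ ν lam 𝓖 s A) (hD : IsOnline 𝓖 s D)
    (hrule : ∀ t ω, IsBackPressure fill (s t ω) (traj s A D t ω) (D t ω)) {κ : ℝ} {φ : State → ℝ}
    (hφ : ∀ (x : State) (d : Channel → Decision), x.V Node.dest = 0 →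
      (∀ c, IsBackPressure fill c x (d c)) →
      lam * x.V Node.source + κ * φ x ≤ ∑ c, (ν c).toReal * (gain c x (d c) : ℝ)) (t : ℕ) :
    ∫ ω, ((traj s A D (t + 1) ω).lyapunov : ℝ) ∂μ + 2 * κ * ∫ ω, φ (traj s A D t ω) ∂μ
      ≤ ∫ ω, ((traj s A D t ω).lyapunov : ℝ) ∂μ + driftBound := by
  -- Tie-breaking may depend on the whole past. The worst tie-break is a function of state and
  -- channel alone, bounds the actual gain from below, and can be averaged over the independent
  -- channel.
  choose d hd hmin using fun x c => exists_min_gain fill c x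
  have hX := traj_discreteMeasurable h hD t
  have hint := fun f => integrable_traj (t := t) h hD f
  set X := traj s A D t with hXdef
  have hR := h.integral_channel hX (fun x c => (gain c x (d x c) : ℝ))
    (fun c => exists_abs_le_traj (fun x => (gain c x (d x c) : ℝ)) t)
  have hRi : Integrable (fun ω => (gain (s t ω) (X ω) (d (X ω) (s t ω)) : ℝ)) μ := by
    choose C hC using fun c => exists_abs_le_traj (s := s) (A := A) (D := D)
      (fun x => (gain c x (d x c) : ℝ)) t
    refine DiscreteMeasurable.integrable (((hX.mono (𝓖.mono (Nat.le_succ t))).map₂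
      (h.discreteMeasurable_channel t) fun x c => (gain c x (d x c) : ℝ)).mono (𝓖.le _))
      (∑ c, |C c|) fun ω => ?_
    exact ((hC _ ω).trans (le_abs_self _)).trans
      (Finset.single_le_sum (f := fun c => |C c|) (fun _ _ => abs_nonneg _) (Finset.mem_univ _))
  have hA : ∫ ω, ((X ω).V Node.source : ℝ) * (if A t ω = true then 1 else 0) ∂μ
      = lam * ∫ ω, ((X ω).V Node.source : ℝ) ∂μ :=
    h.integral_arrival ((hX.comp fun x => (x.V Node.source : ℝ)).mono le_sup_left)
  have hAi : Integrable (fun ω => ((X ω).V Node.source : ℝ) * (if A t ω = true then 1 else 0)) μ := by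
    obtain ⟨C, hC⟩ := exists_abs_le_traj (s := s) (A := A) (D := D)
      (fun x => (x.V Node.source : ℝ)) t
    refine DiscreteMeasurable.integrable (((hX.mono (𝓖.mono (Nat.le_succ t))).map₂
      (h.discreteMeasurable_arrival t) fun x a => (x.V Node.source : ℝ)
        * (if a = true then 1 else 0)).mono (𝓖.le _)) C fun ω => ?_
    refine le_trans ?_ (hC ω)
    split_ifs <;> simp [X]
  have h1 : ∀ ω, ((traj s A D (t + 1) ω).lyapunov : ℝ)
      ≤ (((X ω).lyapunov : ℝ) + driftBound)
        + 2 * ((X ω).V Node.source * (if A t ω = true then 1 else 0)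
          - gain (s t ω) (X ω) (d (X ω) (s t ω))) := by
    intro ω
    have h2 := lyapunov_step_le (s t ω) (D t ω) (A t ω) (x := X ω) (traj_dest t ω)
    have h3 := hmin (X ω) (s t ω) (D t ω) (hrule t ω)
    have h4 : (traj s A D (t + 1) ω).lyapunov ≤ ((X ω).lyapunov + driftBound)
        + 2 * ((X ω).V Node.source * (if A t ω = true then 1 else 0)
          - gain (s t ω) (X ω) (d (X ω) (s t ω))) := by
      refine h2.trans ?_
      linarith
    have h5 := (Int.cast_le (R := ℝ)).2 h4
    push_cast at h5
    exact h5
  have hLi : Integrable (fun ω => ((X ω).lyapunov : ℝ) + driftBound) μ :=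
    (hint fun x => (x.lyapunov : ℝ)).add (integrable_const _)
  have hGi : Integrable (fun ω => 2 * (((X ω).V Node.source : ℝ) * (if A t ω = true then 1 else 0)
      - gain (s t ω) (X ω) (d (X ω) (s t ω)))) μ := (hAi.sub hRi).const_mul 2
  have h2 := integral_mono (integrable_traj h hD (fun x => (x.lyapunov : ℝ)) (t + 1))
    (hLi.add hGi) h1
  simp only [Pi.add_apply] at h2
  rw [integral_add hLi hGi, integral_add (hint fun x => (x.lyapunov : ℝ)) (integrable_const _),
    integral_const_mul,
    integral_sub hAi hRi, hA, hR] at h2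
  have h3 : lam * ∫ ω, ((X ω).V Node.source : ℝ) ∂μ + κ * ∫ ω, φ (X ω) ∂μ
      ≤ ∑ c, (ν c).toReal * ∫ ω, (gain c (X ω) (d (X ω) c) : ℝ) ∂μ := by
    have h4 := integral_mono (((hint fun x => (x.V Node.source : ℝ)).const_mul lam).add
      ((hint φ).const_mul κ)) (integrable_finsetSum Finset.univ fun c _ =>
        (hint fun x => (gain c x (d x c) : ℝ)).const_mul (ν c).toReal)
      (fun ω => hφ (X ω) (d (X ω)) (traj_dest t ω) (hd (X ω)))
    simp only [Pi.add_apply] at h4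
    rw [integral_add ((hint fun x => (x.V Node.source : ℝ)).const_mul lam)
      ((hint φ).const_mul κ), integral_finsetSum _ fun c _ =>
        (hint fun x => (gain c x (d x c) : ℝ)).const_mul (ν c).toReal] at h4
    simpa only [integral_const_mul] using h4
  simp only [integral_const, probReal_univ, one_smul] at h2
  linarith

theorem sum_integral_add_lyapunov_le (h : IsModel μ ν lam 𝓖 s A) (hD : IsOnline 𝓖 s D)
    (hrule : ∀ t ω, IsBackPressure fill (s t ω) (traj s A D t ω) (D t ω)) {κ : ℝ} {φ : State → ℝ}
    (hφ : ∀ (x : State) (d : Channel → Decision), x.V Node.dest = 0 →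
      (∀ c, IsBackPressure fill c x (d c)) →
      lam * x.V Node.source + κ * φ x ≤ ∑ c, (ν c).toReal * (gain c x (d c) : ℝ)) (N : ℕ) :
    2 * κ * ∑ t ∈ Finset.range N, ∫ ω, φ (traj s A D t ω) ∂μ
      + ∫ ω, ((traj s A D N ω).lyapunov : ℝ) ∂μ ≤ driftBound * N := by
  induction N with
  | zero => simp [traj, State.lyapunov, State.empty]
  | succ N ih =>
    have := integral_lyapunov_succ_le h hD hrule hφ N
    rw [Finset.sum_range_succ, mul_add]
    push_cast
    linarith

theorem State.lyapunov_nonneg (x : State) : 0 ≤ x.lyapunov := by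
  unfold State.lyapunov; positivity

theorem sum_integral_le (h : IsModel μ ν lam 𝓖 s A) (hD : IsOnline 𝓖 s D)
    (hrule : ∀ t ω, IsBackPressure fill (s t ω) (traj s A D t ω) (D t ω)) {κ : ℝ} (hκ : 0 < κ)
    {φ : State → ℝ}
    (hφ : ∀ (x : State) (d : Channel → Decision), x.V Node.dest = 0 →
      (∀ c, IsBackPressure fill c x (d c)) →
      lam * x.V Node.source + κ * φ x ≤ ∑ c, (ν c).toReal * (gain c x (d c) : ℝ)) (N : ℕ) :
    ∑ t ∈ Finset.range N, ∫ ω, φ (traj s A D t ω) ∂μ ≤ driftBound / (2 * κ) * N := by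
  have h1 := sum_integral_add_lyapunov_le h hD hrule hφ N
  have h2 : 0 ≤ ∫ ω, ((traj s A D N ω).lyapunov : ℝ) ∂μ :=
    integral_nonneg fun ω => Int.cast_nonneg (State.lyapunov_nonneg _)
  rw [div_mul_eq_mul_div, le_div_iff₀ (by positivity)]
  linarith

variable (hν : ∀ c, ν c ≠ 0) (hlam : lam ∈ interior (stabilityRegion ν))
  (h : IsModel μ ν lam 𝓖 s A) (hD : IsOnline 𝓖 s D)
  (hrule : ∀ t ω, IsBackPressure fill (s t ω) (traj s A D t ω) (D t ω))

include hν hlam h hD hrule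

theorem averageBounded_queue (u : Node) :
    AverageBounded μ fun t ω => ((traj s A D t ω).V u : ℤ) := by
  obtain ⟨κ, hκ, hmargin⟩ := exists_margin fill hν hlam
  refine AverageBounded.of_integral (C := driftBound / (2 * κ))
    (fun t => integrable_traj h hD (fun x => (((x.V u : ℕ) : ℤ) : ℝ)) t) fun N => ?_
  have := sum_integral_le h hD hrule hκ (φ := fun x => (x.V u : ℝ))
    (fun x d hx hd => (hmargin x d hx hd).1 u) N
  simpa using this

theorem averageBounded_reciprocal (p : Pair) :
    AverageBounded μ fun t ω => (traj s A D t ω).H p := by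
  obtain ⟨κ, hκ, hmargin⟩ := exists_margin fill hν hlam
  have hpos := pos_of_mem_interior_stabilityRegion hlam
  -- The margin for the reciprocal queue is available only with a nonempty source.
  let φ : State → ℝ := fun x => if 0 < x.V Node.source then |(x.H p : ℝ)| else 0
  have hφ0 : ∀ x, 0 ≤ φ x := fun x => by
    simp only [φ]; split_ifs <;> simp
  have hsum := sum_integral_le h hD hrule hκ (φ := φ) fun x d hx hd => by
    by_cases hs : 0 < x.V Node.source
    · simpa [φ, hs] using (hmargin x d hx hd).2 hs p
    · have h1 := (hmargin x d hx hd).1 Node.source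
      have h2 : x.V Node.source = 0 := by omega
      simpa [φ, h2] using h1
  -- The arrival of slot `t` is independent of `H` at time `t` and makes the source nonempty at time
  -- `t + 1`, while `H` moves by at most `1`.
  have hstep : ∀ t, lam * ∫ ω, |((traj s A D t ω).H p : ℝ)| ∂μ
      ≤ 1 + ∫ ω, φ (traj s A D (t + 1) ω) ∂μ := by
    intro t
    have hX := traj_discreteMeasurable h hD t
    rw [← h.integral_arrival (t := t) ((hX.comp fun x => |(x.H p : ℝ)|).mono le_sup_left)]
    have hi1 := integrable_traj h hD φ (t + 1)
    have hone : 1 + ∫ ω, φ (traj s A D (t + 1) ω) ∂μ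
        = ∫ ω, (1 + φ (traj s A D (t + 1) ω)) ∂μ := by
      rw [integral_add (integrable_const _) hi1]
      simp
    rw [hone]
    refine integral_mono_of_nonneg (ae_of_all _ fun ω => ?_) ((integrable_const _).add hi1)
      (ae_of_all _ fun ω => ?_)
    · dsimp only [Pi.zero_apply]; split_ifs <;> simp
    · dsimp only
      by_cases hA : A t ω = true
      · have h1 : 0 < (traj s A D (t + 1) ω).V Node.source := by
          rw [traj, hA]; exact step_source_pos _ _ _
        have h2 := abs_step_H_sub_le (s t ω) (D t ω) (A t ω) (traj s A D t ω) p
        have h3 : |((traj s A D (t + 1) ω).H p : ℝ) - (traj s A D t ω).H p| ≤ 1 := by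
          exact_mod_cast h2
        have h4 := abs_sub_abs_le_abs_sub ((traj s A D t ω).H p : ℝ) ((traj s A D (t + 1) ω).H p)
        rw [abs_sub_comm] at h4
        simp only [hA, if_true, φ, h1, mul_one]
        linarith
      · have := hφ0 (traj s A D (t + 1) ω)
        simp only [hA]
        simp only [Bool.false_eq_true, if_false, mul_zero]
        linarith
  refine AverageBounded.of_integral (C := (1 + driftBound / κ) / lam)
    (fun t => integrable_traj h hD (fun x => (x.H p : ℝ)) t) fun N => ?_
  rcases Nat.eq_zero_or_pos N with rfl | hN
  · simp
  have h1 := Finset.sum_le_sum fun t (_ : t ∈ Finset.range N) => hstep t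
  rw [← Finset.mul_sum, Finset.sum_add_distrib] at h1
  have h2 := hsum (N + 1)
  rw [Finset.sum_range_succ'] at h2
  have h3 : 0 ≤ ∫ ω, φ (traj s A D 0 ω) ∂μ := integral_nonneg fun ω => hφ0 _
  have h4 : (1 : ℝ) ≤ N := by exact_mod_cast hN
  -- The shift by one slot costs `N + 1 ≤ 2 * N`, which absorbs the factor `2` in the denominator.
  have h5 : (driftBound : ℝ) / (2 * κ) * ((N + 1 : ℕ) : ℝ) ≤ driftBound / κ * N := by
    have : (driftBound : ℝ) / κ * N = driftBound / (2 * κ) * (2 * N) := by field_simp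
    rw [this]
    push_cast
    gcongr
    linarith
  simp only [Finset.sum_const, Finset.card_range, nsmul_eq_mul, mul_one] at h1
  rw [div_mul_eq_mul_div, le_div_iff₀ hpos]
  linarith

/-- The margin makes the summed work nonnegative, so only the constant second-order term
accumulates. This is the second-moment bound behind the almost sure statements. -/
theorem integral_lyapunov_le (N : ℕ) :
    ∫ ω, ((traj s A D N ω).lyapunov : ℝ) ∂μ ≤ driftBound * N := by
  obtain ⟨κ, hκ, hmargin⟩ := exists_margin fill hν hlam
  have h1 := sum_integral_add_lyapunov_le h hD hrule (φ := fun x => (x.V Node.source : ℝ))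
    (fun x d hx hd => (hmargin x d hx hd).1 Node.source) N
  have h2 : 0 ≤ ∑ t ∈ Finset.range N, ∫ ω, ((traj s A D t ω).V Node.source : ℝ) ∂μ :=
    Finset.sum_nonneg fun t _ => integral_nonneg fun ω => Nat.cast_nonneg _
  have h3 := mul_nonneg (mul_nonneg zero_le_two hκ.le) h2
  linarith

theorem ae_tendsto_queue (u : Node) : ∀ᵐ ω ∂μ,
    Tendsto (fun N : ℕ => ((traj s A D N ω).V u : ℝ) / N) atTop (𝓝 0) := by
  refine ae_tendsto_div_of_sq_integral_le (B := driftBound) (K := 2)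
    (fun N => (((traj_discreteMeasurable h hD N).comp fun x => (x.V u : ℝ)).mono (𝓖.le N)).measurable)
    (fun N => integrable_traj h hD (fun x => (x.V u : ℝ) ^ 2) N) (fun N => ?_) fun N ω => ?_
  · refine le_trans ?_ (integral_lyapunov_le hν hlam h hD hrule N)
    refine integral_mono (integrable_traj h hD (fun x => (x.V u : ℝ) ^ 2) N)
      (integrable_traj h hD (fun x => (x.lyapunov : ℝ)) N) fun ω => ?_
    have h1 : ((traj s A D N ω).V u : ℤ) ^ 2 ≤ (traj s A D N ω).lyapunov :=
      (Finset.single_le_sum (f := fun u => ((traj s A D N ω).V u : ℤ) ^ 2)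
        (fun _ _ => sq_nonneg _) (Finset.mem_univ u)).trans
        (le_add_of_nonneg_right (Finset.sum_nonneg fun _ _ => sq_nonneg _))
    dsimp only
    exact_mod_cast h1
  · have := abs_step_V_sub_le (s N ω) (D N ω) (A N ω) (traj_dest (s := s) (A := A) (D := D) N ω) u
    exact_mod_cast this

theorem ae_tendsto_reciprocal (p : Pair) : ∀ᵐ ω ∂μ,
    Tendsto (fun N : ℕ => ((traj s A D N ω).H p : ℝ) / N) atTop (𝓝 0) := by
  refine ae_tendsto_div_of_sq_integral_le (B := driftBound) (K := 1)
    (fun N => (((traj_discreteMeasurable h hD N).comp fun x => (x.H p : ℝ)).mono (𝓖.le N)).measurable)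
    (fun N => integrable_traj h hD (fun x => (x.H p : ℝ) ^ 2) N) (fun N => ?_) fun N ω => ?_
  · refine le_trans ?_ (integral_lyapunov_le hν hlam h hD hrule N)
    refine integral_mono (integrable_traj h hD (fun x => (x.H p : ℝ) ^ 2) N)
      (integrable_traj h hD (fun x => (x.lyapunov : ℝ)) N) fun ω => ?_
    have h1 : (traj s A D N ω).H p ^ 2 ≤ (traj s A D N ω).lyapunov :=
      (Finset.single_le_sum (f := fun p => (traj s A D N ω).H p ^ 2)
        (fun _ _ => sq_nonneg _) (Finset.mem_univ p)).trans
        (le_add_of_nonneg_left (Finset.sum_nonneg fun _ _ => sq_nonneg _))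
    dsimp only
    exact_mod_cast h1
  · have := abs_step_H_sub_le (s N ω) (D N ω) (A N ω) (traj s A D N ω) p
    exact_mod_cast this

theorem virtualEqualReciprocal : VirtualEqualReciprocal μ s D := by
  have key : ∀ i j : Fin 3, i < j → ∀ᵐ ω ∂μ, Tendsto (fun N : ℕ =>
      ((∑ t ∈ Finset.range N, (n (s t ω) (D t ω) i j - n (s t ω) (D t ω) j i) : ℤ) : ℝ) / (N : ℝ))
      atTop (𝓝 0) := by
    intro i j hij
    filter_upwards [ae_tendsto_reciprocal hν hlam h hD hrule ⟨(i, j), hij⟩] with ω hω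
    simpa only [traj_H_eq_sum] using hω
  intro i j
  rcases lt_trichotomy i j with hij | rfl | hij
  · exact key i j hij
  · exact ae_of_all _ fun ω => by simp
  · filter_upwards [key j i hij] with ω hω
    refine (neg_zero (G := ℝ) ▸ hω.neg).congr fun N => ?_
    rw [← neg_div, ← Int.cast_neg, ← Finset.sum_neg_distrib]
    simp only [neg_sub]

end Model

/-! ### Real packets inside the virtual network -/

/-- What the virtual node of a packet says about the users who have the packet and about its
holder. -/
def Located (h : Channel) (o : Option (Fin 3)) : Node → Prop
  | .source => h = (fun _ => false) ∧ o = none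
  | .user i => o = some i
  | .status r => h = r ∧ (r ≠ (fun _ => true) → o = none)

/-- Number of packets at a node. -/
def queueCount (pos : ℕ → Node) (num : ℕ) (u : Node) : ℤ :=
  ∑ k ∈ Finset.range num, if pos k = u then 1 else 0

/-- Number of packets that `i` holds and that `j` has not received. -/
def pendingCount (y : Network) (pos : ℕ → Node) (i j : Fin 3) : ℤ :=
  ∑ k ∈ Finset.range y.num, if pos k = .user i ∧ y.has k j = false then 1 else 0

/-- The virtual nodes `pos` of the packets are consistent with the state of the network. -/
structure Coherent (y : Network) (pos : ℕ → Node) : Prop where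
  located : ∀ k, Located (y.has k) (y.holder k) (pos k)
  fresh : ∀ k, y.num ≤ k → pos k = .source

theorem queueCount_nonneg (pos : ℕ → Node) (num : ℕ) (u : Node) : 0 ≤ queueCount pos num u :=
  Finset.sum_nonneg fun k _ => by split_ifs <;> simp

theorem queueCount_pos {pos : ℕ → Node} {num k : ℕ} (hk : k < num) {u : Node} (hu : pos k = u) :
    0 < queueCount pos num u := by
  refine Finset.sum_pos' (fun k _ => by split_ifs <;> simp) ⟨k, Finset.mem_range.2 hk, ?_⟩
  simp [hu]

theorem queueCount_eq_zero {pos : ℕ → Node} {num : ℕ} {u : Node} (h : ∀ k < num, pos k ≠ u) :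
    queueCount pos num u = 0 :=
  Finset.sum_eq_zero fun k hk => by simp [h k (Finset.mem_range.1 hk)]

theorem posStep_transmission (l : Link) (k : ℕ) (pos : ℕ → Node) :
    posStep (some l) (l.transmission k) pos = Function.update pos k l.head := by
  unfold Link.transmission
  split <;> rfl

theorem posStep_idle (d : Decision) (pos : ℕ → Node) : posStep d .idle pos = pos := by
  cases d <;> rfl

theorem Corresponds.cases {pos : ℕ → Node} {num : ℕ} {d : Decision} {T : Transmission}
    (h : Corresponds pos num d T) :
    (T = .idle ∧ ∀ l, d = some l → ∀ k < num, pos k ≠ l.tail) ∨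
      ∃ l k, d = some l ∧ k < num ∧ pos k = l.tail ∧ T = l.transmission k := by
  cases d with
  | none => exact Or.inl ⟨h, fun l hl => by simp at hl⟩
  | some l =>
    rcases h with ⟨k, h1, h2, h3⟩ | ⟨h1, h2⟩
    · exact Or.inr ⟨l, k, rfl, h1, h2, h3⟩
    · refine Or.inl ⟨h2, fun l' hl' => ?_⟩
      rw [← Option.some.inj hl']
      exact h1

section Step

variable {s : Channel} {y : Network} {pos : ℕ → Node}

theorem Coherent.allowed_transmission (hc : Coherent y pos) {l : Link}
    (hon : l.tail.IsOn s l.head) {k : ℕ} (hk : k < y.num) (hpos : pos k = l.tail) :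
    y.Allowed s (l.transmission k) := by
  have hloc := hc.located k
  rw [hpos] at hloc
  obtain ⟨⟨u, v⟩, hl⟩ := l
  rcases u with _ | i | r <;> rcases v with _ | i' | r' <;> try exact hl.elim
  · exact ⟨hk, hloc.2, fun j => congrFun hloc.1 j, hon⟩
  · exact ⟨hk, hloc.2⟩
  · exact ⟨hk, hloc⟩
  · refine ⟨hk, hloc.2 ?_⟩
    rintro rfl
    exact hl.1 (funext fun i => (hl.2 i rfl).symm)

theorem Coherent.located_transmission (hc : Coherent y pos) {l : Link}
    (hon : l.tail.IsOn s l.head) {k : ℕ} (hpos : pos k = l.tail) (a : Bool) (j : ℕ) :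
    Located ((y.step s (l.transmission k) a).has j) ((y.step s (l.transmission k) a).holder j)
      (Function.update pos k l.head j) := by
  have hloc := hc.located k
  rw [hpos] at hloc
  by_cases hj : j = k
  · subst hj
    rw [Function.update_self]
    obtain ⟨⟨u, v⟩, hl⟩ := l
    rcases u with _ | i | r <;> rcases v with _ | i' | r' <;> try exact hl.elim
    · simp [Network.step, Link.transmission, Link.tail, Link.head, Located]
    · refine ⟨?_, fun _ => hloc.2⟩
      simp only [Network.step, Link.transmission, Link.tail, Link.head, Function.update_self,
        hloc.1, Bool.false_or]
      exact funext hon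
    · have hr' : r' = fun _ => true := hl
      refine ⟨?_, fun h => absurd hr' h⟩
      simp [Network.step, Link.transmission, Link.tail, Link.head, hr']
    · have hr : r ≠ fun _ => true := by
        rintro rfl
        exact hl.1 (funext fun i => (hl.2 i rfl).symm)
      refine ⟨?_, fun _ => hloc.2 hr⟩
      simp only [Network.step, Link.transmission, Link.tail, Link.head, Function.update_self,
        hloc.1]
      -- The ON condition fixes the users who lacked the packet; the order condition on links keeps
      -- those who had it.
      funext i
      cases hi : r i
      · exact hon i hi
      · rw [hl.2 i hi]; rfl
  · have h1 := hc.located j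
    rw [Function.update_of_ne hj]
    obtain ⟨⟨u, v⟩, hl⟩ := l
    rcases u with _ | i | r <;> rcases v with _ | i' | r' <;>
      simpa [Network.step, Link.transmission, Link.tail, Link.head, Function.update_of_ne hj]
        using h1

theorem Coherent.allowed (hc : Coherent y pos) {d : Decision} {T : Transmission}
    (hon : ∀ l, d = some l → l.tail.IsOn s l.head) (hT : Corresponds pos y.num d T) :
    y.Allowed s T := by
  rcases hT.cases with ⟨rfl, -⟩ | ⟨l, k, hd, hk, hpos, rfl⟩
  · trivial
  · exact hc.allowed_transmission (hon l hd) hk hpos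

theorem Coherent.step (hc : Coherent y pos) {d : Decision} {T : Transmission}
    (hon : ∀ l, d = some l → l.tail.IsOn s l.head) (hT : Corresponds pos y.num d T) (a : Bool) :
    Coherent (y.step s T a) (posStep d T pos) := by
  have hnum : ∀ j, (y.step s T a).num ≤ j → y.num ≤ j := by
    intro j hj
    have : (y.step s T a).num = y.num + if a = true then 1 else 0 := rfl
    omega
  rcases hT.cases with ⟨rfl, -⟩ | ⟨l, k, rfl, hk, hpos, rfl⟩
  · rw [posStep_idle]
    exact ⟨hc.located, fun j hj => hc.fresh j (hnum j hj)⟩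
  · rw [posStep_transmission]
    refine ⟨hc.located_transmission (hon l rfl) hpos a, fun j hj => ?_⟩
    have := hnum j hj
    rw [Function.update_of_ne (by omega)]
    exact hc.fresh j this

theorem queueCount_step_idle (hc : Coherent y pos) (a : Bool) (u : Node) :
    queueCount pos (y.num + if a = true then 1 else 0) u
      = queueCount pos y.num u + if u = Node.source ∧ a = true then 1 else 0 := by
  rw [queueCount, sum_range_add, hc.fresh _ le_rfl, ← queueCount]
  cases a <;> simp [eq_comm]

theorem queueCount_step_transmission (hc : Coherent y pos) {l : Link} {k : ℕ} (hk : k < y.num)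
    (hpos : pos k = l.tail) (a : Bool) (u : Node) :
    queueCount (Function.update pos k l.head) (y.num + if a = true then 1 else 0) u
      = queueCount pos y.num u - (if l.tail = u then 1 else 0) + (if l.head = u then 1 else 0)
        + if u = Node.source ∧ a = true then 1 else 0 := by
  rw [queueCount, sum_range_add_of_eq_off (f := fun k => if pos k = u then 1 else 0) hk
    (fun j hj => by rw [Function.update_of_ne hj]), hc.fresh _ le_rfl, Function.update_self, hpos,
    queueCount]
  cases a <;> simp [eq_comm] <;> ring

/-- A real packet moves together with its virtual counterpart. If there is none to send, the real
count at the tail is already zero, while the virtual head still gains a fill packet; this is why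
only an inequality survives. -/
theorem queueCount_step_le (hc : Coherent y pos) {x : State} {d : Decision} {T : Transmission}
    (hT : Corresponds pos y.num d T) (a : Bool) {u : Node} (hu : u ≠ Node.dest)
    (hx : queueCount pos y.num u ≤ x.V u) :
    queueCount (posStep d T pos) (y.step s T a).num u ≤ (SocialGrouping.step s d a x).V u := by
  have hnum : (y.step s T a).num = y.num + if a = true then 1 else 0 := rfl
  rw [hnum]
  simp only [SocialGrouping.step, if_neg hu]
  rcases hT.cases with ⟨rfl, hd⟩ | ⟨l, k, rfl, hk, hpos, rfl⟩
  · rw [posStep_idle, queueCount_step_idle hc]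
    have h0 : d.map Link.tail = some u → queueCount pos y.num u = 0 := by
      intro h
      obtain ⟨l, hl, rfl⟩ := Option.map_eq_some_iff.1 h
      exact queueCount_eq_zero (hd l hl)
    have h1 := queueCount_nonneg pos y.num u
    split_ifs <;> simp_all <;> omega
  · rw [posStep_transmission, queueCount_step_transmission hc hk hpos]
    have h0 : l.tail = u → 0 < queueCount pos y.num u := fun h => queueCount_pos hk (hpos.trans h)
    simp only [Option.map_some, Option.some.injEq]
    by_cases h : l.tail = u
    · have := h0 h
      simp only [h, if_true]
      split_ifs <;> omega
    · simp only [h, if_false]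
      split_ifs <;> omega

theorem queueCount_step_eq (hc : Coherent y pos) {x : State} {d : Decision} {T : Transmission}
    (hd : ∀ l, d = some l → l.tail ≠ Node.dest ∧ 0 < x.V l.tail)
    (hT : Corresponds pos y.num d T) (a : Bool)
    (hx : ∀ u, u ≠ Node.dest → queueCount pos y.num u = x.V u) {u : Node} (hu : u ≠ Node.dest) :
    queueCount (posStep d T pos) (y.step s T a).num u = (SocialGrouping.step s d a x).V u := by
  have hnum : (y.step s T a).num = y.num + if a = true then 1 else 0 := rfl
  rw [hnum]
  simp only [SocialGrouping.step, if_neg hu]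
  have hxu := hx u hu
  rcases hT.cases with ⟨rfl, hd'⟩ | ⟨l, k, rfl, hk, hpos, rfl⟩
  -- Without fill packets a scheduled link has a nonempty virtual tail, hence a real packet there,
  -- so an idle slot can come only from scheduling nothing.
  · have hnone : d = none := by
      cases d with
      | none => rfl
      | some l =>
        have h1 := queueCount_eq_zero (hd' l rfl)
        have h2 := hd l rfl
        rw [hx _ h2.1] at h1
        omega
    subst hnone
    rw [posStep_idle, queueCount_step_idle hc, hxu]
    simp
  · rw [posStep_transmission, queueCount_step_transmission hc hk hpos]
    have h0 := (hd l rfl).2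
    simp only [Option.map_some, Option.some.injEq]
    by_cases h : l.tail = u
    · rw [h] at h0
      simp only [h, if_true]
      split_ifs <;> omega
    · simp only [h, if_false]
      split_ifs <;> omega

/-- The packets that `i` gets in order to share them with `j` are delivered or pending. -/
theorem n_eq_pendingCount_step (hc : Coherent y pos) {d : Decision} {T : Transmission}
    (hd : ∀ l, d = some l → ∃ k < y.num, pos k = l.tail)
    (hT : Corresponds pos y.num d T) (a : Bool) (i j : Fin 3) :
    n s d i j = pendingCount (y.step s T a) (posStep d T pos) i j - pendingCount y pos i j
      + y.shared T i j := by
  rcases hT.cases with ⟨rfl, hd'⟩ | ⟨l, k, rfl, hk, hpos, rfl⟩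
  · have hnone : d = none := by
      cases d with
      | none => rfl
      | some l =>
        obtain ⟨k, h1, h2⟩ := hd l rfl
        exact absurd h2 (hd' l rfl k h1)
    subst hnone
    have h1 : pendingCount (y.step s .idle a) (posStep none .idle pos) i j = _ :=
      sum_range_add (fun k => if pos k = .user i ∧ y.has k j = false then 1 else 0) y.num a
    rw [h1, Network.shared_idle, hc.fresh _ le_rfl]
    simp [n, pendingCount]
  · have hloc := hc.located k
    rw [hpos] at hloc
    rw [posStep_transmission]
    have h1 : pendingCount (y.step s (l.transmission k) a) (Function.update pos k l.head) i j = _ :=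
      sum_range_add_of_eq_off
        (f := fun k => if pos k = .user i ∧ y.has k j = false then 1 else 0) hk
        (fun b hb => by
          obtain ⟨⟨u, v⟩, hl⟩ := l
          rcases u with _ | i | r <;> rcases v with _ | i' | r' <;>
          simp [Network.step, Link.transmission, Link.tail, Link.head,
            Function.update_of_ne hb]) a
    rw [h1, hc.fresh _ le_rfl, Function.update_self, hpos]
    simp only [pendingCount, add_sub_cancel_left, reduceCtorEq, false_and,
      if_false, ite_self, add_zero]
    obtain ⟨⟨u, v⟩, hl⟩ := l
    rcases u with _ | i' | r <;> rcases v with _ | i'' | r' <;> try exact hl.elim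
    · simp [Link.transmission, Link.tail, Link.head, Network.shared_bs, Network.step, n, hloc.1]
    · simp [Link.transmission, Link.tail, Link.head, Network.shared_bs, n]
    · simp [Link.transmission, Link.tail, Link.head, Network.shared_d2d, promised, n]
    · simp [Link.transmission, Link.tail, Link.head, Network.shared_bs, n]

end Step

theorem pendingCount_nonneg (y : Network) (pos : ℕ → Node) (i j : Fin 3) :
    0 ≤ pendingCount y pos i j :=
  Finset.sum_nonneg fun k _ => by split_ifs <;> simp

theorem pendingCount_le_queueCount (y : Network) (pos : ℕ → Node) (i j : Fin 3) :
    pendingCount y pos i j ≤ queueCount pos y.num (.user i) := by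
  refine Finset.sum_le_sum fun k _ => ?_
  by_cases h : pos k = .user i
  · simp only [h, true_and, if_true]; split_ifs <;> simp
  · simp [h]

theorem Coherent.backlog_le {y : Network} {pos : ℕ → Node} (hc : Coherent y pos) :
    (y.backlog : ℤ) ≤ ∑ u ∈ Finset.univ.erase Node.dest, queueCount pos y.num u := by
  unfold Network.backlog queueCount
  rw [Finset.card_filter, Nat.cast_sum, Finset.sum_comm]
  refine Finset.sum_le_sum fun k _ => ?_
  rw [Finset.sum_ite_eq]
  by_cases h : ∃ i, y.has k i = false
  · have : pos k ≠ Node.dest := by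
      intro hp
      have h1 := hc.located k
      rw [hp] at h1
      obtain ⟨i, hi⟩ := h
      rw [h1.1] at hi
      exact absurd hi (by simp)
    simp [h, this]
  · simp only [h, if_false]
    split_ifs <;> simp

section Pathwise

variable {Ω : Type*} {s : ℕ → Ω → Channel} {A : ℕ → Ω → Bool} {D : ℕ → Ω → Decision}
  {T : ℕ → Ω → Transmission} {fill : Bool}

theorem IsBackPressure.admissible {s : Channel} {x : State} {d : Decision}
    (h : IsBackPressure fill s x d) (l : Link) (hl : d = some l) : Admissible fill s x l := by
  subst hl; exact h.1

theorem Link.tail_ne_dest (l : Link) : l.tail ≠ Node.dest := by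
  obtain ⟨⟨u, v⟩, hl⟩ := l
  rintro rfl
  rcases v with _ | i | r
  · exact hl
  · exact hl
  · exact hl.1 (funext fun i => (hl.2 i rfl).symm)

variable (hrule : ∀ t ω, IsBackPressure fill (s t ω) (traj s A D t ω) (D t ω))
  (hpacket : ∀ t ω, Corresponds (posTraj D T t ω) (netTraj s A T t ω).num (D t ω) (T t ω))

include hrule hpacket

theorem coherent_netTraj (t : ℕ) (ω : Ω) : Coherent (netTraj s A T t ω) (posTraj D T t ω) := by
  induction t with
  | zero => exact ⟨fun k => ⟨rfl, rfl⟩, fun k _ => rfl⟩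
  | succ t ih => exact ih.step (fun l hl => ((hrule t ω).admissible l hl).1) (hpacket t ω) _

theorem queueCount_le_traj (t : ℕ) (ω : Ω) {u : Node} (hu : u ≠ Node.dest) :
    queueCount (posTraj D T t ω) (netTraj s A T t ω).num u ≤ (traj s A D t ω).V u := by
  induction t with
  | zero => simp [queueCount, netTraj, Network.empty]
  | succ t ih =>
    exact queueCount_step_le (coherent_netTraj hrule hpacket t ω) (hpacket t ω) _ hu ih

theorem backlog_le_sum_queue (t : ℕ) (ω : Ω) :
    ((netTraj s A T t ω).backlog : ℤ) ≤ ∑ u, ((traj s A D t ω).V u : ℤ) := by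
  refine (coherent_netTraj hrule hpacket t ω).backlog_le.trans ?_
  refine (Finset.sum_le_sum fun u hu =>
    queueCount_le_traj hrule hpacket t ω (Finset.ne_of_mem_erase hu)).trans ?_
  exact Finset.sum_le_sum_of_subset_of_nonneg (Finset.erase_subset _ _) fun _ _ _ => by positivity

theorem queueCount_eq_traj (hfill : fill = false) (t : ℕ) (ω : Ω) :
    ∀ u, u ≠ Node.dest →
      queueCount (posTraj D T t ω) (netTraj s A T t ω).num u = (traj s A D t ω).V u := by
  induction t with
  | zero =>
    intro u _
    simp [queueCount, netTraj, Network.empty, traj, State.empty]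
  | succ t ih =>
    intro u hu
    exact queueCount_step_eq (coherent_netTraj hrule hpacket t ω)
      (fun l hl => ⟨l.tail_ne_dest, ((hrule t ω).admissible l hl).2 hfill⟩) (hpacket t ω) _ ih hu

theorem sum_n_eq (hfill : fill = false) (i j : Fin 3) (N : ℕ) (ω : Ω) :
    ∑ t ∈ Finset.range N, n (s t ω) (D t ω) i j
      = pendingCount (netTraj s A T N ω) (posTraj D T N ω) i j
        + ∑ t ∈ Finset.range N, (netTraj s A T t ω).shared (T t ω) i j := by
  induction N with
  | zero => simp [pendingCount, netTraj, Network.empty]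
  | succ N ih =>
    rw [Finset.sum_range_succ, Finset.sum_range_succ, ih,
      n_eq_pendingCount_step (coherent_netTraj hrule hpacket N ω) ?_ (hpacket N ω) (A N ω) i j]
    · rw [netTraj, posTraj]
      ring
    · intro l hl
      by_contra! hcon
      have h1 := queueCount_eq_zero hcon
      have h2 := ((hrule N ω).admissible l hl).2 hfill
      rw [queueCount_eq_traj hrule hpacket hfill N ω _ l.tail_ne_dest] at h1
      omega

end Pathwise

end SocialGrouping

theorem mainTheorem1 (fill : Bool)
    (ν : PMF SocialGrouping.Channel) (hν : ∀ c, ν c ≠ 0)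
    (lam : ℝ) (hlam : lam ∈ interior (SocialGrouping.stabilityRegion ν))
    {Ω : Type*} [m : MeasurableSpace Ω] (μ : Measure Ω) [IsProbabilityMeasure μ]
    (𝓖 : Filtration ℕ m)
    (s : ℕ → Ω → SocialGrouping.Channel) (A : ℕ → Ω → Bool)
    (D : ℕ → Ω → SocialGrouping.Decision) (T : ℕ → Ω → SocialGrouping.Transmission)
    (hmodel : SocialGrouping.IsModel μ ν lam 𝓖 s A)
    (hrun : SocialGrouping.IsAlgorithmRun fill 𝓖 s A D T) :
    SocialGrouping.VirtualQueuesStable μ s A D ∧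
      SocialGrouping.ReciprocalQueuesStable μ s A D ∧
      SocialGrouping.VirtualEqualReciprocal μ s D ∧
      SocialGrouping.IsSchedule 𝓖 s A T ∧
      SocialGrouping.QueueStable μ s A T ∧
      (fill = false → SocialGrouping.EqualReciprocal μ s A T) := by
  have hD := hrun.online_link
  have hrule := hrun.rule
  have hpacket := hrun.packet
  have hV := SocialGrouping.averageBounded_queue hν hlam hmodel hD hrule
  have hn := SocialGrouping.virtualEqualReciprocal hν hlam hmodel hD hrule
  refine ⟨fun u => (hV u).stable,
    fun p => (SocialGrouping.averageBounded_reciprocal hν hlam hmodel hD hrule p).stable, hn,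
    ⟨hrun.online_packet, fun t ω => ?_⟩, ?_, fun hfill i j => ?_⟩
  · exact (SocialGrouping.coherent_netTraj hrule hpacket t ω).allowed
      (fun l hl => ((hrule t ω).admissible l hl).1) (hpacket t ω)
  · refine (SocialGrouping.AverageBounded.of_le_sum hV (fun u t => ?_) fun t ω => ?_).stable
    · exact (((SocialGrouping.traj_discreteMeasurable hmodel hD t).comp
        fun x => ((x.V u : ℕ) : ℤ)).mono (𝓖.le t)).measurable
    · simpa using SocialGrouping.backlog_le_sum_queue hrule hpacket t ω
  · filter_upwards [hn i j,
      SocialGrouping.ae_tendsto_queue hν hlam hmodel hD hrule (.user i),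
      SocialGrouping.ae_tendsto_queue hν hlam hmodel hD hrule (.user j)] with ω h1 h2 h3
    -- Pending packets sit in the queue of the sharing user, which is `o(N)`; they account for the
    -- whole difference between scheduled and delivered shares.
    have hpend : ∀ i j : Fin 3, Tendsto (fun N : ℕ => ((SocialGrouping.traj s A D N ω).V (.user i) : ℝ)
        / N) atTop (𝓝 0) → Tendsto (fun N : ℕ => (SocialGrouping.pendingCount
        (SocialGrouping.netTraj s A T N ω) (SocialGrouping.posTraj D T N ω) i j : ℝ) / N)
        atTop (𝓝 0) := by
      intro i j h
      refine squeeze_zero (fun N => ?_) (fun N => ?_) h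
      · exact div_nonneg (Int.cast_nonneg (SocialGrouping.pendingCount_nonneg _ _ _ _))
          (Nat.cast_nonneg N)
      · have h4 := (SocialGrouping.pendingCount_le_queueCount (SocialGrouping.netTraj s A T N ω)
          (SocialGrouping.posTraj D T N ω) i j).trans
          (SocialGrouping.queueCount_le_traj hrule hpacket N ω (by simp [SocialGrouping.Node.dest]))
        gcongr
        exact_mod_cast h4
    have h4 := (h1.sub (hpend i j h2)).add (hpend j i h3)
    simp only [sub_zero, add_zero] at h4
    refine h4.congr fun N => ?_
    rw [Finset.sum_sub_distrib, Finset.sum_sub_distrib,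
      SocialGrouping.sum_n_eq hrule hpacket hfill i j N ω,
      SocialGrouping.sum_n_eq hrule hpacket hfill j i N ω]
    push_cast
    ring
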